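/- Conventions. All matrices are real unless said otherwise; $|\cdot|$ is the 2-norm; $\otimes$ is the Kronecker product; $\mathbf 1$ is the all-ones vector. $A\in\mathbb R^{n\times n}$ is *neutrally stable* if it has no (complex) eigenvalue of magnitude greater than one and every Jordan block of an eigenvalue of magnitude one has size one. A pair $(C,A)$, with $C\in\mathbb R^{m\times n}$, is *detectable* if $CA^kx=0$ for all $k\ge 0$ implies $\lim_{k\to\infty}A^kx=0$; a pair $(A,B)$ is *stabilizable* if $(B^T,A^T)$ is detectable. A matrix $\Lambda=[\lambda_{ij}]\in\mathbb R^{p\times p}$ is *connected* if $\lambda_{ii}>0$ and $\lambda_{ij}\ge 0$ for all $i,j$, each row sums to $1$, and the directed graph on $\{1,\dots,p\}$ with an arc from $i$ to $j$ iff $\lambda_{ij}>0$ has a node to which there is a path from every other node. Construction of $L$. Let $A\in\mathbb R^{n\times n}$ be neutrally stable and $C\in\mathbb R^{m\times n}$. Let $n_1$ be the number of eigenvalues of $A$ of magnitude one, counted with algebraic multiplicity, and let $n_2=n-n_1$. If $n_1=0$, put $L=0\in\mathbb R^{n\times m}$. Otherwise: 1. Choose $U\in\mathbb R^{n\times n_1}$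 and $W\in\mathbb R^{n\times n_2}$ such that $[U\ W]$ is invertible and $[U\ W]^{-1}A[U\ W]=\begin{bmatrix}F&0\\0&G\end{bmatrix}$, where all eigenvalues of $F\in\mathbb R^{n_1\times n_1}$ have magnitude one. If $CU$ has full row rank, put $E=I_m$, $q=m$. In general choose $E\in\mathbb R^{q\times m}$ such that $ECU$ has full row rank $q$ and $\operatorname{rank}(ECU)=\operatorname{rank}(CU)$, and put $\widehat C=EC$. (When $CU$ has full row rank, every admissible $E$ is invertible and gives the same $L$ below as $E=I_m$.) 2. Choose $R=R^T>0$ in $\mathbb R^{n_1\times n_1}$ with $F^TRF=R$. 3. Choose $H\in\mathbb R^{q\times n_1}$ with $\operatorname{range}(H^T)=\operatorname{range}(R^{-1/2}U^T\widehat C^T)$ and $HH^T=I_q$. 4. Put $L=UFR^{-1/2}H^T(\widehat CUR^{-1/2}H^T)^{-1}E\in\mathbb R^{n\times m}$. Theorem. Let $A\in\mathbb R^{n\times n}$ be neutrally stable and let $C\in\mathbb R^{m\times n}$ be such that $(A^T,C^T)$ is stabilizable. The construction above can be carried out, and every $L$ that it can produce has the following property. For every $p$ and every connected $\Lambda=[\lambda_{ij}]\in\mathbb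 R^{p\times p}$, there is exactly one $r\in\mathbb R^p$ with $r^T\Lambda=r^T$ and $r^T\mathbf 1=1$, and all solutions of the coupled systems $$x_i^+=A^Tx_i+C^Tu_i,\qquad u_i=L^Tz_i,\qquad z_i=\sum_{j=1}^p\lambda_{ij}(x_j-x_i),\qquad i=1,\dots,p,$$ (with arbitrary initial states $x_1(0),\dots,x_p(0)\in\mathbb R^n$) synchronize to $$\bar x(k):=(r^T\otimes (A^k)^T)\begin{bmatrix}x_1(0)\\ \vdots\\ x_p(0)\end{bmatrix},$$ that is, $|x_i(k)-\bar x(k)|\to 0$ as $k\to\infty$ for every $i$. -/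

import Mathlib

open Filter Topology
open scoped Matrix Kronecker

namespace SyncDual

/-- The real matrix `A` regarded as a linear endomorphism of `ℂⁿ`. -/
noncomputable def complexEnd {n : ℕ} (A : Matrix (Fin n) (Fin n) ℝ) :
    Module.End ℂ (Fin n → ℂ) :=
  Matrix.toLin' (A.map (algebraMap ℝ ℂ))

/-- Discrete-time neutral stability: no (complex) eigenvalue has magnitude greater than one, and
every Jordan block of an eigenvalue of magnitude one has size one, that is, each generalized
eigenvector for such an eigenvalue is an eigenvector. -/
def NeutrallyStable {n : ℕ} (A : Matrix (Fin n) (Fin n) ℝ) : Prop :=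
  (∀ μ : ℂ, (complexEnd A).HasEigenvalue μ → ‖μ‖ ≤ 1) ∧
  (∀ μ : ℂ, (complexEnd A).HasEigenvalue μ → ‖μ‖ = 1 →
    (complexEnd A).maxGenEigenspace μ = (complexEnd A).eigenspace μ)

/-- Discrete-time detectability of the pair `(C, A)`. -/
def Detectable {n m : ℕ} (C : Matrix (Fin m) (Fin n) ℝ) (A : Matrix (Fin n) (Fin n) ℝ) : Prop :=
  ∀ x : Fin n → ℝ, (∀ k : ℕ, (C * A ^ k) *ᵥ x = 0) →
    Tendsto (fun k : ℕ => (A ^ k) *ᵥ x) atTop (𝓝 0)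

/-- Discrete-time stabilizability of the pair `(A, B)`. -/
def Stabilizable {n m : ℕ} (A : Matrix (Fin n) (Fin n) ℝ) (B : Matrix (Fin n) (Fin m) ℝ) : Prop :=
  Detectable Bᵀ Aᵀ

/-- The matrix `Λ` is connected (in the discrete-time sense): it is entrywise nonnegative with
positive diagonal, its rows sum to one, and its graph (arc from `i` to `j` iff `0 < Λ i j`) has a
node to which there is a path from every other node. -/
structure IsConnected {p : ℕ} (Λ : Matrix (Fin p) (Fin p) ℝ) : Prop where
  diag_pos : ∀ i, 0 < Λ i i
  nonneg : ∀ i j, 0 ≤ Λ i j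
  row_sum : ∀ i, ∑ j, Λ i j = 1
  graph : ∃ t : Fin p, ∀ s : Fin p, Relation.ReflTransGen (fun i j => 0 < Λ i j) s t

open Classical in
/-- The number of complex eigenvalues of `A` of magnitude one, counted with algebraic
multiplicity. -/
noncomputable def unitEigCount {n : ℕ} (A : Matrix (Fin n) (Fin n) ℝ) : ℕ :=
  (A.map (algebraMap ℝ ℂ)).charpoly.roots.countP (fun z => ‖z‖ = 1)

/-- The construction of the gain `L` from `A` and an output matrix `C` for which `C U` has full
row rank. Here `T` is the inverse of the square matrix `[U W]`, and `S` is the positive definite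
square root of `R`, so that `S⁻¹` is `R ^ (-1/2)`. -/
def GainSteps {n m n₁ n₂ : ℕ} (A : Matrix (Fin n) (Fin n) ℝ) (C : Matrix (Fin m) (Fin n) ℝ)
    (U : Matrix (Fin n) (Fin n₁) ℝ) (W : Matrix (Fin n) (Fin n₂) ℝ)
    (L : Matrix (Fin n) (Fin m) ℝ) : Prop :=
  ∃ (T : Matrix (Fin n₁ ⊕ Fin n₂) (Fin n) ℝ)
    (F : Matrix (Fin n₁) (Fin n₁) ℝ) (G : Matrix (Fin n₂) (Fin n₂) ℝ)
    (R S : Matrix (Fin n₁) (Fin n₁) ℝ) (H : Matrix (Fin m) (Fin n₁) ℝ),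
    T * Matrix.fromCols U W = 1 ∧ Matrix.fromCols U W * T = 1 ∧
    T * A * Matrix.fromCols U W = Matrix.fromBlocks F 0 0 G ∧
    (∀ μ : ℂ, (complexEnd F).HasEigenvalue μ → ‖μ‖ = 1) ∧
    (C * U).rank = m ∧
    R.PosDef ∧ Fᵀ * R * F = R ∧
    S.PosDef ∧ S * S = R ∧
    LinearMap.range (Hᵀ).mulVecLin = LinearMap.range (S⁻¹ * Uᵀ * Cᵀ).mulVecLin ∧
    H * Hᵀ = 1 ∧
    L = U * F * S⁻¹ * Hᵀ * (C * U * S⁻¹ * Hᵀ)⁻¹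

/-- `L` is a possible outcome of the algorithm for `(A, C)`. If `A` has no eigenvalue of magnitude
one then `L = 0`. Otherwise the output is first compressed to `y' = E y` with `E C U` of full row
rank and of the same rank as `C U` (so no information on the critical modes is lost; this is the
reduction to the case where `C U` has full row rank), and the gain `L'` built for `E C` is applied
to `y'`. When `C U` has full row rank one may take `E = 1`, and every admissible `E` is then
invertible and yields the same gain as `E = 1`. -/
def IsAlgorithmGain {n m : ℕ} (A : Matrix (Fin n) (Fin n) ℝ) (C : Matrix (Fin m) (Fin n) ℝ)
    (L : Matrix (Fin n) (Fin m) ℝ) : Prop :=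
  (unitEigCount A = 0 ∧ L = 0) ∨
  (unitEigCount A ≠ 0 ∧
    ∃ (U : Matrix (Fin n) (Fin (unitEigCount A)) ℝ)
      (W : Matrix (Fin n) (Fin (n - unitEigCount A)) ℝ)
      (q : ℕ) (E : Matrix (Fin q) (Fin m) ℝ) (L' : Matrix (Fin n) (Fin q) ℝ),
      (E * C * U).rank = (C * U).rank ∧ GainSteps A (E * C) U W L' ∧ L = L' * E)

/-- The diffusive full-state information `zᵢ = ∑ⱼ λᵢⱼ (xⱼ - xᵢ)` available to system `i`. -/
noncomputable def coupling {n p : ℕ} (Λ : Matrix (Fin p) (Fin p) ℝ) (x : Fin p → Fin n → ℝ)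
    (i : Fin p) : Fin n → ℝ :=
  ∑ j, Λ i j • (x j - x i)

/-- `x i k` is the state at time `k` of the system `xᵢ⁺ = Aᵀ xᵢ + Cᵀ uᵢ` with `uᵢ = K zᵢ`. -/
def IsSolution {n m p : ℕ} (A : Matrix (Fin n) (Fin n) ℝ) (C : Matrix (Fin m) (Fin n) ℝ)
    (K : Matrix (Fin m) (Fin n) ℝ) (Λ : Matrix (Fin p) (Fin p) ℝ)
    (x : Fin p → ℕ → Fin n → ℝ) : Prop :=
  ∀ i k, x i (k + 1) = Aᵀ *ᵥ x i k + Cᵀ *ᵥ (K *ᵥ coupling Λ (fun j => x j k) i)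

/-- The maps `ξ i` synchronize to `ξbar`: `|ξᵢ(k) - ξbar(k)| → 0` in the 2-norm for all `i`. -/
def SynchronizeTo {n p : ℕ} (ξ : Fin p → ℕ → Fin n → ℝ) (ξbar : ℕ → Fin n → ℝ) : Prop :=
  ∀ i, Tendsto (fun k => ‖WithLp.toLp 2 (ξ i k - ξbar k)‖) atTop (𝓝 0)

/-- The vector `(rᵀ ⊗ M) [v₁; …; v_p]` of `ℝⁿ`. -/
def kronApply {n p : ℕ} (r : Fin p → ℝ) (M : Matrix (Fin n) (Fin n) ℝ) (v : Fin p → Fin n → ℝ) :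
    Fin n → ℝ :=
  fun l => ((Matrix.replicateRow Unit r ⊗ₖ M) *ᵥ (fun ij : Fin p × Fin n => v ij.1 ij.2)) ((), l)

end SyncDual

/-!
Stack the states of the coupled systems as the rows of a matrix `X`. The closed loop is
`X ↦ X A + (Λ - 1) X (L C)`, which commutes with left multiplication by `Λ`. If `r` is the
normalized left fixed vector of `Λ`, then the average `r X` evolves by `A` alone and is exactly the
trajectory to which the systems should synchronize. The disagreement `X - 1 (r X)` obeys the same
closed loop on the invariant space of matrices with `r X = 0`, so it suffices that the closed loop
has all its eigenvalues on that space in the open unit disc (`norm_lt_one_of_hasEigenvalue_loopMap`).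

An eigenvector for an eigenvalue `μ` can be chosen with `Λ X = l X`. Here `l = 1` is impossible:
the graph condition would make all rows equal, hence zero. By Gershgorin's theorem and the positive
diagonal, `|l| < 1`. A nonzero row `y` then satisfies `y A + (l - 1) y L C = μ y`. On the critical
block of `A`, with `c = y U R ^ (-1/2)`, this equation becomes `d (1 - P) + l d P = μ c` with
`d = c O`, where `O` is orthogonal and `P = Hᵀ H` is an orthogonal projection; this is what the
choice of `L` achieves. Hence `|μ|² |c|² = |d|² - (1 - |l|²) |d P|²` and `|d| = |c|`, so `|μ| < 1`
unless `c` gives a unit eigenvector of `F` which is invisible through the output. The latter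
contradicts detectability (`norm_lt_one_of_gain`). If the critical component `y U` vanishes, so does
the feedback, and `μ` is an eigenvalue of the remaining block `G`, which has no eigenvalue on the
unit circle because `F` already accounts for all of them.

For the existence of `L`, the real characteristic polynomial of `A` is split into the part with unit
roots and the rest (`exists_unit_splitting`). Neutral stability makes the critical block `F`
diagonalizable over `ℂ`, and the coordinates in an eigenbasis provide the invariant form `R`.
-/

/-! ### Fixed vectors and eigenvalues of a connected stochastic matrix -/

namespace SyncDual.IsConnected

variable {p : ℕ} {Λ : Matrix (Fin p) (Fin p) ℝ}

lemma mulVec_one (hΛ : IsConnected Λ) : Λ *ᵥ 1 = 1 := by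
  ext i
  simp [Matrix.mulVec, dotProduct, hΛ.row_sum i]

/-- A left fixed vector stays fixed when replaced by its absolute value: `|r| ≤ |r| Λ` holds
entrywise, and both sides have the same sum of entries. -/
lemma abs_vecMul (hΛ : IsConnected Λ) {r : Fin p → ℝ} (hr : r ᵥ* Λ = r) :
    (fun i => |r i|) ᵥ* Λ = fun i => |r i| := by
  have hle : ∀ j ∈ Finset.univ, |r j| ≤ ((fun i => |r i|) ᵥ* Λ) j := by
    intro j _
    have h := congrFun hr j
    simp only [Matrix.vecMul, dotProduct] at h ⊢
    calc |r j| = |∑ i, r i * Λ i j| := by rw [h]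
      _ ≤ ∑ i, |r i * Λ i j| := Finset.abs_sum_le_sum_abs _ _
      _ = ∑ i, |r i| * Λ i j :=
        Finset.sum_congr rfl fun i _ => by rw [abs_mul, abs_of_nonneg (hΛ.nonneg i j)]
  have hsum : ∑ j, |r j| = ∑ j, ((fun i => |r i|) ᵥ* Λ) j := by
    simp only [Matrix.vecMul, dotProduct]
    rw [Finset.sum_comm]
    simp [← Finset.mul_sum, hΛ.row_sum]
  ext j
  exact ((Finset.sum_eq_sum_iff_of_le hle).1 hsum j (Finset.mem_univ j)).symm

/-- The support of a nonnegative left fixed vector is closed under following arcs, so it contains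
every node that can be reached from all others. -/
lemma pos_of_vecMul_eq (hΛ : IsConnected Λ) {t : Fin p}
    (ht : ∀ s, Relation.ReflTransGen (fun i j => 0 < Λ i j) s t) {r : Fin p → ℝ}
    (h0 : ∀ i, 0 ≤ r i) (hr : r ᵥ* Λ = r) (hne : r ≠ 0) : 0 < r t := by
  obtain ⟨i, hi⟩ := Function.ne_iff.1 hne
  have hi : 0 < r i := lt_of_le_of_ne (h0 i) (Ne.symm hi)
  have hit := ht i
  clear ht
  induction hit with
  | refl => exact hi
  | @tail b c _ hbc ih =>
    have h := congrFun hr c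
    simp only [Matrix.vecMul, dotProduct] at h
    rw [← h]
    exact Finset.sum_pos' (fun j _ => mul_nonneg (h0 j) (hΛ.nonneg j c))
      ⟨b, Finset.mem_univ b, mul_pos ih hbc⟩

/-- A left fixed vector whose entries sum to zero vanishes: its positive and negative parts are
left fixed as well, and they cannot both be positive at the node reached from all others. -/
lemma eq_zero_of_vecMul_eq (hΛ : IsConnected Λ) {d : Fin p → ℝ} (hd : d ᵥ* Λ = d)
    (hsum : ∑ i, d i = 0) : d = 0 := by
  obtain ⟨t, ht⟩ := hΛ.graph
  have habs := hΛ.abs_vecMul hd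
  by_contra hne
  have hpos : 0 < (fun i => |d i| + d i) t := by
    refine hΛ.pos_of_vecMul_eq (r := fun i => |d i| + d i) ht
      (fun i => by linarith [neg_abs_le (d i)]) ?_ fun h => hne ?_
    · exact (Matrix.add_vecMul _ _ _).trans (congrArg₂ _ habs hd)
    · have hz : ∀ i ∈ Finset.univ, d i ≤ 0 := fun i _ => by
        have := congrFun h i
        simp only [Pi.zero_apply] at this
        linarith [abs_nonneg (d i)]
      ext i
      exact (Finset.sum_eq_zero_iff_of_nonpos hz).1 hsum i (Finset.mem_univ i)
  have hneg : 0 < (fun i => |d i| - d i) t := by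
    refine hΛ.pos_of_vecMul_eq (r := fun i => |d i| - d i) ht
      (fun i => by linarith [le_abs_self (d i)]) ?_ fun h => hne ?_
    · exact (Matrix.sub_vecMul _ _ _).trans (congrArg₂ _ habs hd)
    · have hz : ∀ i ∈ Finset.univ, 0 ≤ d i := fun i _ => by
        have := congrFun h i
        simp only [Pi.zero_apply] at this
        linarith [abs_nonneg (d i)]
      ext i
      exact (Finset.sum_eq_zero_iff_of_nonneg hz).1 hsum i (Finset.mem_univ i)
  simp only at hpos hneg
  rcases abs_cases (d t) with h | h <;> linarith

lemma existsUnique_left_fixed (hΛ : IsConnected Λ) :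
    ∃! r : Fin p → ℝ, r ᵥ* Λ = r ∧ r ⬝ᵥ 1 = 1 := by
  obtain ⟨t, -⟩ := hΛ.graph
  have hdet : (Λ - 1).det = 0 := by
    refine Matrix.exists_mulVec_eq_zero_iff.1 ⟨1, fun h => ?_, ?_⟩
    · simpa using congrFun h t
    · rw [Matrix.sub_mulVec, hΛ.mulVec_one, Matrix.one_mulVec, sub_self]
  obtain ⟨v, hv0, hv⟩ := Matrix.exists_vecMul_eq_zero_iff.2 hdet
  rw [Matrix.vecMul_sub, Matrix.vecMul_one, sub_eq_zero] at hv
  set s : ℝ := ∑ i, |v i|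
  have hs : s ≠ 0 := fun h => hv0 <| by
    ext i
    exact abs_eq_zero.1
      ((Finset.sum_eq_zero_iff_of_nonneg fun i _ => abs_nonneg (v i)).1 h i (Finset.mem_univ i))
  refine ⟨s⁻¹ • fun i => |v i|, ⟨?_, ?_⟩, fun r hr => ?_⟩
  · rw [Matrix.smul_vecMul, hΛ.abs_vecMul hv]
  · rw [smul_dotProduct, dotProduct_one, smul_eq_mul, inv_mul_cancel₀ hs]
  · rw [← sub_eq_zero]
    apply hΛ.eq_zero_of_vecMul_eq
    · rw [Matrix.sub_vecMul, Matrix.smul_vecMul, hΛ.abs_vecMul hv, hr.1]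
    · have h1 := hr.2
      rw [dotProduct_one] at h1
      simp only [Pi.sub_apply, Finset.sum_sub_distrib, h1, Pi.smul_apply, smul_eq_mul,
        ← Finset.mul_sum]
      rw [inv_mul_cancel₀ hs, sub_self]

/-- Maximum principle: a right fixed vector attains its maximum at the node reached from all
others, because the set of maximizers is closed under following arcs. -/
lemma le_of_mulVec_eq (hΛ : IsConnected Λ) {t : Fin p}
    (ht : ∀ s, Relation.ReflTransGen (fun i j => 0 < Λ i j) s t) {x : Fin p → ℝ}
    (hx : Λ *ᵥ x = x) (i : Fin p) : x i ≤ x t := by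
  obtain ⟨m, -, hm⟩ := Finset.exists_max_image Finset.univ x ⟨t, Finset.mem_univ t⟩
  suffices x t = x m from this ▸ hm i (Finset.mem_univ i)
  have hmt := ht m
  clear ht
  induction hmt with
  | refl => rfl
  | @tail b c _ hbc ih =>
    have h := congrFun hx b
    simp only [Matrix.mulVec, dotProduct] at h
    have hz : ∑ j, Λ b j * (x m - x j) = 0 := by
      simp only [mul_sub, Finset.sum_sub_distrib, h, ← Finset.sum_mul, hΛ.row_sum, ih]
      ring
    have := (Finset.sum_eq_zero_iff_of_nonneg fun j _ => mul_nonneg (hΛ.nonneg b j)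
      (sub_nonneg.2 (hm j (Finset.mem_univ j)))).1 hz c (Finset.mem_univ c)
    rcases mul_eq_zero.1 this with h | h
    · exact absurd h hbc.ne'
    · linarith

lemma exists_forall_eq_of_mulVec_eq (hΛ : IsConnected Λ) :
    ∃ t, ∀ x : Fin p → ℝ, Λ *ᵥ x = x → ∀ i, x i = x t := by
  obtain ⟨t, ht⟩ := hΛ.graph
  refine ⟨t, fun x hx i => le_antisymm (hΛ.le_of_mulVec_eq ht hx i) ?_⟩
  have := hΛ.le_of_mulVec_eq ht (x := -x) (by rw [Matrix.mulVec_neg, hx]) i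
  simpa using this

/-- The discs of Gershgorin's theorem lie in the unit disc and touch the unit circle only at `1`,
because the diagonal is positive. -/
lemma eigenvalue_eq_one_or_norm_lt_one (hΛ : IsConnected Λ) {l : ℂ}
    (hl : (complexEnd Λ).HasEigenvalue l) : l = 1 ∨ ‖l‖ < 1 := by
  obtain ⟨k, hk⟩ := eigenvalue_mem_ball hl
  have hsum : ∑ j ∈ Finset.univ.erase k, ‖(Λ.map (algebraMap ℝ ℂ)) k j‖ = 1 - Λ k k := by
    rw [← hΛ.row_sum k, ← Finset.sum_erase_eq_sub (Finset.mem_univ k)]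
    exact Finset.sum_congr rfl fun j _ => by simp [abs_of_nonneg (hΛ.nonneg k j)]
  rw [hsum, mem_closedBall_iff_norm, Matrix.map_apply, Complex.coe_algebraMap] at hk
  have h1 : ‖l - (Λ k k : ℂ)‖ ^ 2 ≤ (1 - Λ k k) ^ 2 := by gcongr
  have h2 : ‖l‖ ^ 2 = l.re * l.re + l.im * l.im := by
    rw [← Complex.normSq_apply, Complex.normSq_eq_norm_sq]
  rw [← Complex.normSq_eq_norm_sq, Complex.normSq_apply] at h1
  simp only [Complex.sub_re, Complex.ofReal_re, Complex.sub_im, Complex.ofReal_im, sub_zero] at h1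
  have hd := hΛ.diag_pos k
  have hre : l.re ≤ 1 := by
    have := (Complex.abs_re_le_norm (l - (Λ k k : ℂ))).trans hk
    simp only [Complex.sub_re, Complex.ofReal_re] at this
    linarith [le_abs_self (l.re - Λ k k)]
  rcases hre.eq_or_lt with h | h
  · left
    apply Complex.ext
    · simpa using h
    · rw [h] at h1
      have : l.im * l.im = 0 := le_antisymm (by linarith) (mul_self_nonneg _)
      simpa using this
  · right
    have : ‖l‖ ^ 2 < 1 := by nlinarith [mul_pos hd (sub_pos.2 h)]
    exact (sq_lt_one_iff₀ (norm_nonneg l)).1 this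

end SyncDual.IsConnected

/-! ### Powers of an endomorphism with all eigenvalues in the open unit disc -/

namespace SyncDual

section Powers

attribute [local instance] Matrix.linftyOpNormedRing Matrix.linftyOpNormedAlgebra

/-- If every eigenvalue of `N` has norm less than one, then `N ^ k → 0` by Gelfand's formula.
Convergence is tested against linear functionals, so that `V` needs no topology. -/
theorem tendsto_pow_apply_of_eigenvalue_norm_lt_one {V : Type*} [AddCommGroup V] [Module ℂ V]
    [FiniteDimensional ℂ V] (N : Module.End ℂ V) (hN : ∀ μ, N.HasEigenvalue μ → ‖μ‖ < 1)
    (φ : V →ₗ[ℂ] ℂ) (v : V) : Tendsto (fun k : ℕ => φ ((N ^ k) v)) atTop (𝓝 0) := by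
  rcases subsingleton_or_nontrivial V with hV | hV
  · simp [Subsingleton.elim _ (0 : V)]
  let e := LinearMap.toMatrixAlgEquiv (Module.finBasis ℂ V)
  have : Nonempty (Fin (Module.finrank ℂ V)) := ⟨⟨0, Module.finrank_pos⟩⟩
  have hrad : spectralRadius ℂ (e N) < (1 : NNReal) := by
    refine spectrum.spectralRadius_lt_of_forall_lt _ fun z hz => ?_
    rw [AlgEquiv.spectrum_eq e N] at hz
    exact_mod_cast hN z (Module.End.hasEigenvalue_iff_mem_spectrum.2 hz)
  obtain ⟨s, hs1, hs2⟩ := ENNReal.lt_iff_exists_nnreal_btwn.1 hrad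
  have hs2 : (s : ℝ) < 1 := by exact_mod_cast hs2
  have hpow : Tendsto (fun k : ℕ => e N ^ k) atTop (𝓝 0) := by
    refine squeeze_zero_norm' ?_ (tendsto_pow_atTop_nhds_zero_of_lt_one s.coe_nonneg hs2)
    have hg := (spectrum.pow_nnnorm_pow_one_div_tendsto_nhds_spectralRadius (e N)).eventually
      (eventually_lt_nhds hs1)
    filter_upwards [hg, eventually_gt_atTop 0] with k hk hk0
    have hk0' : (k : ℝ) ≠ 0 := by positivity
    have h := ENNReal.rpow_le_rpow hk.le (Nat.cast_nonneg (α := ℝ) k)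
    rw [← ENNReal.rpow_mul, one_div_mul_cancel hk0', ENNReal.rpow_one, ENNReal.rpow_natCast] at h
    exact_mod_cast h
  let ψ : Matrix (Fin (Module.finrank ℂ V)) (Fin (Module.finrank ℂ V)) ℂ →ₗ[ℂ] ℂ :=
    φ ∘ₗ LinearMap.applyₗ v ∘ₗ e.symm.toLinearMap
  have hψ := (ψ.continuous_of_finiteDimensional.tendsto 0).comp hpow
  rw [map_zero] at hψ
  refine hψ.congr fun k => ?_
  simp [ψ, ← map_pow]

end Powers

/-- Commuting endomorphisms `f`, `g` of a complex space: every eigenvalue of `f` has an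
eigenvector that is also an eigenvector of `g`. -/
lemma exists_common_eigenvector {V : Type*} [AddCommGroup V] [Module ℂ V]
    [FiniteDimensional ℂ V] {f g : Module.End ℂ V} (hfg : Commute f g) {μ : ℂ}
    (hμ : f.HasEigenvalue μ) : ∃ (l : ℂ) (v : V), v ≠ 0 ∧ f v = μ • v ∧ g v = l • v := by
  have hmaps : ∀ v ∈ f.eigenspace μ, g v ∈ f.eigenspace μ :=
    Module.End.mapsTo_genEigenspace_of_comm hfg μ 1
  have : Nontrivial (f.eigenspace μ) := Submodule.nontrivial_iff_ne_bot.2 hμ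
  obtain ⟨l, hl⟩ := Module.End.exists_eigenvalue (LinearMap.restrict g hmaps)
  obtain ⟨v, hv⟩ := hl.exists_hasEigenvector
  refine ⟨l, v, fun h => hv.2 (Subtype.ext h), Module.End.mem_eigenspace_iff.1 v.2, ?_⟩
  simpa using congrArg Subtype.val hv.apply_eq_smul

/-! ### Complexification of real matrices -/

/-- The real matrix `A` with its entries regarded as complex numbers. -/
noncomputable abbrev cplx {ι κ : Type*} (A : Matrix ι κ ℝ) : Matrix ι κ ℂ := A.map (algebraMap ℝ ℂ)

lemma cplx_mul {ι κ τ : Type*} [Fintype κ] (A : Matrix ι κ ℝ) (B : Matrix κ τ ℝ) :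
    cplx (A * B) = cplx A * cplx B := Matrix.map_mul

lemma cplx_add {ι κ : Type*} (A B : Matrix ι κ ℝ) : cplx (A + B) = cplx A + cplx B :=
  Matrix.map_add _ (map_add _) A B

lemma cplx_sub {ι κ : Type*} (A B : Matrix ι κ ℝ) : cplx (A - B) = cplx A - cplx B :=
  Matrix.map_sub _ (map_sub _) A B

lemma cplx_one {ι : Type*} [DecidableEq ι] : cplx (1 : Matrix ι ι ℝ) = 1 := by
  simp [cplx]

lemma cplx_conjTranspose {ι κ : Type*} (A : Matrix ι κ ℝ) : (cplx A)ᴴ = cplx Aᵀ := by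
  ext i j
  simp

lemma cplx_mulVec_re {ι κ : Type*} [Fintype κ] (A : Matrix ι κ ℝ) (u : κ → ℂ) (i : ι) :
    ((cplx A *ᵥ u) i).re = (A *ᵥ fun j => (u j).re) i := by
  simp [Matrix.mulVec, dotProduct]

lemma cplx_mulVec_im {ι κ : Type*} [Fintype κ] (A : Matrix ι κ ℝ) (u : κ → ℂ) (i : ι) :
    ((cplx A *ᵥ u) i).im = (A *ᵥ fun j => (u j).im) i := by
  simp [Matrix.mulVec, dotProduct]

lemma cplx_mulVec_eq_zero_iff {ι κ : Type*} [Fintype κ] {A : Matrix ι κ ℝ} {u : κ → ℂ} :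
    cplx A *ᵥ u = 0 ↔ A *ᵥ (fun j => (u j).re) = 0 ∧ A *ᵥ (fun j => (u j).im) = 0 := by
  simp only [funext_iff, Complex.ext_iff, cplx_mulVec_re, cplx_mulVec_im, Pi.zero_apply,
    Complex.zero_re, Complex.zero_im, forall_and]

lemma cplx_pow_mulVec {n : ℕ} {A : Matrix (Fin n) (Fin n) ℝ} {μ : ℂ} {w : Fin n → ℂ}
    (h : cplx A *ᵥ w = μ • w) (k : ℕ) : cplx (A ^ k) *ᵥ w = μ ^ k • w := by
  induction k with
  | zero => rw [pow_zero, cplx_one, Matrix.one_mulVec, pow_zero, one_smul]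
  | succ k ih =>
    rw [pow_succ, cplx_mul, ← Matrix.mulVec_mulVec, h, Matrix.mulVec_smul, ih, smul_smul,
      pow_succ']

lemma cplx_mulVec_injective {n n₁ : ℕ} {U : Matrix (Fin n) (Fin n₁) ℝ}
    {V : Matrix (Fin n₁) (Fin n) ℝ} (hVU : V * U = 1) {u : Fin n₁ → ℂ}
    (hu : cplx U *ᵥ u = 0) : u = 0 := by
  rw [← Matrix.one_mulVec u, ← cplx_one, ← hVU, cplx_mul, ← Matrix.mulVec_mulVec, hu,
    Matrix.mulVec_zero]

lemma toRows_mul_eq_one {n n₁ n₂ : ℕ} {T : Matrix (Fin n₁ ⊕ Fin n₂) (Fin n) ℝ}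
    {U : Matrix (Fin n) (Fin n₁) ℝ} {W : Matrix (Fin n) (Fin n₂) ℝ}
    (h : T * Matrix.fromCols U W = 1) : T.toRows₁ * U = 1 ∧ T.toRows₂ * W = 1 := by
  rw [← Matrix.fromRows_toRows T, Matrix.fromRows_mul_fromCols, ← Matrix.fromBlocks_one] at h
  obtain ⟨h₁, -, -, h₂⟩ := Matrix.fromBlocks_inj.1 h
  exact ⟨h₁, h₂⟩

lemma hasEigenvalue_iff_isRoot_charpoly {n : ℕ} {A : Matrix (Fin n) (Fin n) ℝ} {μ : ℂ} :
    (complexEnd A).HasEigenvalue μ ↔ (cplx A).charpoly.IsRoot μ := by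
  rw [Module.End.hasEigenvalue_iff_isRoot_charpoly, complexEnd, Matrix.charpoly_toLin']

lemma hasEigenvalue_of_vecMul_eq {n : ℕ} {A : Matrix (Fin n) (Fin n) ℝ} {μ : ℂ} {y : Fin n → ℂ}
    (hy : y ≠ 0) (h : y ᵥ* cplx A = μ • y) : (complexEnd A).HasEigenvalue μ := by
  rw [hasEigenvalue_iff_isRoot_charpoly, ← Matrix.charpoly_transpose, ← Matrix.charpoly_toLin',
    ← Module.End.hasEigenvalue_iff_isRoot_charpoly]
  refine Module.End.hasEigenvalue_of_hasEigenvector (x := y)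
    ⟨Module.End.mem_eigenspace_iff.2 ?_, hy⟩
  rw [Matrix.toLin'_apply, Matrix.mulVec_transpose, h]

/-! ### Counting eigenvalues on the unit circle -/

lemma unitEigCount_eq_zero_iff {n : ℕ} {A : Matrix (Fin n) (Fin n) ℝ} :
    unitEigCount A = 0 ↔ ∀ μ, (complexEnd A).HasEigenvalue μ → ‖μ‖ ≠ 1 := by
  simp only [unitEigCount, Multiset.countP_eq_zero, hasEigenvalue_iff_isRoot_charpoly,
    Polynomial.mem_roots (Matrix.charpoly_monic _).ne_zero]

lemma unitEigCount_eq_of_forall {n : ℕ} {A : Matrix (Fin n) (Fin n) ℝ}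
    (h : ∀ μ, (complexEnd A).HasEigenvalue μ → ‖μ‖ = 1) : unitEigCount A = n := by
  have hr : ∀ μ ∈ (cplx A).charpoly.roots, ‖μ‖ = 1 := fun μ hμ =>
    h μ (hasEigenvalue_iff_isRoot_charpoly.2 (Polynomial.isRoot_of_mem_roots hμ))
  rw [unitEigCount, Multiset.countP_eq_card.2 hr,
    ← (IsAlgClosed.splits _).natDegree_eq_card_roots, Matrix.charpoly_natDegree_eq_dim,
    Fintype.card_fin]

lemma unitEigCount_of_block {n n₁ n₂ : ℕ} {A : Matrix (Fin n) (Fin n) ℝ}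
    {N : Matrix (Fin n) (Fin n₁ ⊕ Fin n₂) ℝ} {T : Matrix (Fin n₁ ⊕ Fin n₂) (Fin n) ℝ}
    {F : Matrix (Fin n₁) (Fin n₁) ℝ} {G : Matrix (Fin n₂) (Fin n₂) ℝ}
    (hTN : T * N = 1) (hNT : N * T = 1) (h : T * A * N = Matrix.fromBlocks F 0 0 G) :
    unitEigCount A = unitEigCount F + unitEigCount G := by
  have hcard : Fintype.card (Fin n₁ ⊕ Fin n₂) = Fintype.card (Fin n) :=
    Matrix.square_of_invertible T N hTN hNT
  have hchar : A.charpoly = F.charpoly * G.charpoly := by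
    rw [← Matrix.charpoly_fromBlocks_zero₁₂ F 0 G, ← h,
      Matrix.charpoly_mul_comm_of_le (T * A) N hcard.ge, hcard, Nat.sub_self, pow_zero, one_mul,
      ← Matrix.mul_assoc, hNT, Matrix.one_mul]
  have hchar' : (cplx A).charpoly = (cplx F).charpoly * (cplx G).charpoly := by
    simp only [cplx, Matrix.charpoly_map, hchar, Polynomial.map_mul]
  unfold unitEigCount
  rw [hchar', Polynomial.roots_mul (mul_ne_zero (Matrix.charpoly_monic _).ne_zero
    (Matrix.charpoly_monic _).ne_zero), Multiset.countP_add]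

/-! ### The spectral estimate for a single mode of the coupling -/

lemma star_dotProduct_self_eq {ι : Type*} [Fintype ι] (v : ι → ℂ) :
    star v ⬝ᵥ v = ((∑ i, ‖v i‖ ^ 2 : ℝ) : ℂ) := by
  simp [dotProduct, Complex.conj_mul']

lemma sum_norm_sq_add_smul {ι : Type*} [Fintype ι] {w y : ι → ℂ} (h : star y ⬝ᵥ w = 0) (l : ℂ) :
    ∑ i, ‖(w + l • y) i‖ ^ 2 = ∑ i, ‖w i‖ ^ 2 + ‖l‖ ^ 2 * ∑ i, ‖y i‖ ^ 2 := by
  have h' : star w ⬝ᵥ y = 0 := by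
    have := congrArg star h
    rwa [← Matrix.star_dotProduct_star, star_star, star_zero] at this
  have hl : star l * l = ((‖l‖ ^ 2 : ℝ) : ℂ) := by simp [Complex.conj_mul']
  apply Complex.ofReal_injective
  rw [Complex.ofReal_add, Complex.ofReal_mul, ← star_dotProduct_self_eq, ← star_dotProduct_self_eq,
    ← star_dotProduct_self_eq, ← hl]
  simp only [star_add, star_smul, add_dotProduct, dotProduct_add, smul_dotProduct,
    dotProduct_smul, h, h', smul_eq_mul]
  ring

/-- Let `O` be unitary, `P` an orthogonal projection and `|l| < 1`. The operator
`(1 - P) O + l P O` does not increase norms, and preserves the norm of `c` only if `P O c = 0`.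
So its eigenvalues lie in the open unit disc, except for eigenvalues of `O` with an eigenvector
that is annihilated by `P`. -/
lemma norm_lt_one_or_of_damped {ι : Type*} [Fintype ι] [DecidableEq ι] {O P : Matrix ι ι ℂ}
    (hO : Oᴴ * O = 1) (hP : Pᴴ = P) (hPP : P * P = P) {l μ : ℂ} (hl : ‖l‖ < 1) {c : ι → ℂ}
    (hc : c ≠ 0) (h : O *ᵥ c + (l - 1) • (P *ᵥ (O *ᵥ c)) = μ • c) :
    ‖μ‖ < 1 ∨ (‖μ‖ = 1 ∧ O *ᵥ c = μ • c ∧ P *ᵥ c = 0) := by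
  set d := O *ᵥ c with hd
  have hnd : ∑ i, ‖d i‖ ^ 2 = ∑ i, ‖c i‖ ^ 2 := by
    apply Complex.ofReal_injective
    rw [← star_dotProduct_self_eq, ← star_dotProduct_self_eq, hd, Matrix.star_mulVec,
      ← Matrix.dotProduct_mulVec, Matrix.mulVec_mulVec, hO, Matrix.one_mulVec]
  have horth : star (P *ᵥ d) ⬝ᵥ (d - P *ᵥ d) = 0 := by
    rw [Matrix.star_mulVec, ← Matrix.dotProduct_mulVec, Matrix.mulVec_sub,
      hP, Matrix.mulVec_mulVec d P P, hPP, sub_self, dotProduct_zero]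
  have h1 := sum_norm_sq_add_smul horth 1
  have h2 := sum_norm_sq_add_smul horth l
  rw [one_smul, sub_add_cancel, norm_one, one_pow, one_mul] at h1
  rw [show d - P *ᵥ d + l • (P *ᵥ d) = μ • c by rw [← h]; module] at h2
  have hc0 : 0 < ∑ i, ‖c i‖ ^ 2 := by
    obtain ⟨i, hi⟩ := Function.ne_iff.1 hc
    exact Finset.sum_pos' (fun _ _ => by positivity)
      ⟨i, Finset.mem_univ i, by have := norm_pos_iff.2 hi; positivity⟩
  have hμ : ∑ i, ‖(μ • c) i‖ ^ 2 = ‖μ‖ ^ 2 * ∑ i, ‖c i‖ ^ 2 := by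
    simp only [Pi.smul_apply, smul_eq_mul, norm_mul, mul_pow, Finset.mul_sum]
  rw [hμ] at h2
  have hl2 : ‖l‖ ^ 2 < 1 := (sq_lt_one_iff₀ (norm_nonneg l)).2 hl
  by_cases hy : P *ᵥ d = 0
  · right
    rw [hy, smul_zero, add_zero] at h
    have hn : ‖μ‖ = 1 := by
      have : ‖μ‖ ^ 2 * ∑ i, ‖c i‖ ^ 2 = 1 * ∑ i, ‖c i‖ ^ 2 := by rw [← hμ, ← h, hnd, one_mul]
      exact (pow_eq_one_iff_of_nonneg (norm_nonneg μ) two_ne_zero).1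
        (mul_right_cancel₀ hc0.ne' this)
    have hμ0 : μ ≠ 0 := norm_ne_zero_iff.1 (by rw [hn]; exact one_ne_zero)
    rw [h, Matrix.mulVec_smul] at hy
    exact ⟨hn, h, (smul_eq_zero.1 hy).resolve_left hμ0⟩
  · left
    have hy0 : 0 < ∑ i, ‖(P *ᵥ d) i‖ ^ 2 := by
      obtain ⟨i, hi⟩ := Function.ne_iff.1 hy
      exact Finset.sum_pos' (fun _ _ => by positivity)
        ⟨i, Finset.mem_univ i, by have := norm_pos_iff.2 hi; positivity⟩
    have : ‖μ‖ ^ 2 * ∑ i, ‖c i‖ ^ 2 < 1 * ∑ i, ‖c i‖ ^ 2 := by nlinarith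
    exact (sq_lt_one_iff₀ (norm_nonneg μ)).1 (lt_of_mul_lt_mul_right this hc0.le)

end SyncDual

/-! ### The gain makes every decaying mode of the coupling stable -/

namespace SyncDual

/-- Detectability rules out unobservable unit modes: such a mode would have to decay, but its norm
is constant. -/
lemma Detectable.eq_zero_of_unit_mode {n m n₁ : ℕ} {A : Matrix (Fin n) (Fin n) ℝ}
    {C : Matrix (Fin m) (Fin n) ℝ} (hC : Detectable C A) {U : Matrix (Fin n) (Fin n₁) ℝ}
    {F : Matrix (Fin n₁) (Fin n₁) ℝ} (hAU : A * U = U * F) {u : Fin n₁ → ℂ} {ν : ℂ}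
    (hν : ‖ν‖ = 1) (hu : cplx F *ᵥ u = ν • u) (hCu : cplx (C * U) *ᵥ u = 0) :
    cplx U *ᵥ u = 0 := by
  set w := cplx U *ᵥ u with hw
  have hAw : ∀ k : ℕ, cplx (A ^ k) *ᵥ w = ν ^ k • w := by
    refine cplx_pow_mulVec ?_
    rw [hw, Matrix.mulVec_mulVec, ← cplx_mul, hAU, cplx_mul, ← Matrix.mulVec_mulVec, hu,
      Matrix.mulVec_smul]
  have hCw : ∀ k : ℕ, cplx (C * A ^ k) *ᵥ w = 0 := by
    intro k
    rw [cplx_mul, ← Matrix.mulVec_mulVec, hAw, Matrix.mulVec_smul, hw, Matrix.mulVec_mulVec,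
      ← cplx_mul, hCu, smul_zero]
  have hre := hC _ fun k => (cplx_mulVec_eq_zero_iff.1 (hCw k)).1
  have him := hC _ fun k => (cplx_mulVec_eq_zero_iff.1 (hCw k)).2
  ext i
  have hz : Tendsto (fun k : ℕ => ((cplx (A ^ k) *ᵥ w) i)) atTop (𝓝 0) := by
    have h1 := (tendsto_pi_nhds.1 hre i).ofReal
    have h2 := (tendsto_pi_nhds.1 him i).ofReal.mul_const Complex.I
    have h3 := h1.add h2
    simp only [Pi.zero_apply, Complex.ofReal_zero, zero_mul, add_zero] at h3
    refine h3.congr fun k => ?_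
    rw [← cplx_mulVec_re, ← cplx_mulVec_im]
    exact Complex.re_add_im _
  have hn : Tendsto (fun _ : ℕ => ‖w i‖) atTop (𝓝 0) := by
    have := hz.norm
    rw [norm_zero] at this
    refine this.congr fun k => ?_
    rw [hAw, Pi.smul_apply, smul_eq_mul, norm_mul, norm_pow, hν, one_pow, one_mul]
  exact norm_eq_zero.1 (tendsto_nhds_unique tendsto_const_nhds hn)

/-- If `E M` has the same rank as `M`, then multiplication by `E` loses nothing of `M`. -/
lemma mulVec_eq_zero_of_rank_eq {n m q : ℕ} {M : Matrix (Fin m) (Fin n) ℝ}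
    {E : Matrix (Fin q) (Fin m) ℝ} (h : (E * M).rank = M.rank) {x : Fin n → ℝ}
    (hx : (E * M) *ᵥ x = 0) : M *ᵥ x = 0 := by
  have hle : LinearMap.ker M.mulVecLin ≤ LinearMap.ker (E * M).mulVecLin := by
    intro y hy
    rw [LinearMap.mem_ker, Matrix.mulVecLin_apply] at hy ⊢
    rw [← Matrix.mulVec_mulVec, hy, Matrix.mulVec_zero]
  have hdim : Module.finrank ℝ (LinearMap.ker M.mulVecLin) =
      Module.finrank ℝ (LinearMap.ker (E * M).mulVecLin) := by
    have h1 := LinearMap.finrank_range_add_finrank_ker M.mulVecLin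
    have h2 := LinearMap.finrank_range_add_finrank_ker (E * M).mulVecLin
    rw [Matrix.rank, Matrix.rank] at h
    omega
  have : x ∈ LinearMap.ker (E * M).mulVecLin := hx
  rw [← Submodule.eq_of_le_of_finrank_eq hle hdim] at this
  exact this

/-- A containment of column spaces is a factorization. -/
lemma exists_eq_mul_of_range_le {a b c : ℕ} {M : Matrix (Fin a) (Fin b) ℝ}
    {N : Matrix (Fin a) (Fin c) ℝ}
    (h : LinearMap.range M.mulVecLin ≤ LinearMap.range N.mulVecLin) :
    ∃ X : Matrix (Fin c) (Fin b) ℝ, M = N * X := by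
  have hcol : ∀ j, ∃ x, N *ᵥ x = M.col j := fun j => by
    have : M.col j ∈ LinearMap.range M.mulVecLin := ⟨Pi.single j 1, by simp⟩
    exact h this
  choose X hX using hcol
  refine ⟨(Matrix.of X)ᵀ, ?_⟩
  ext i j
  exact (congrFun (hX j) i).symm

/-- In the coordinates `c = a R ^ (-1/2)` of the critical block, the closed loop of a coupling mode
`l` is `c ↦ c O (1 + (l - 1) P)`, with the orthogonal matrix `O = R ^ (1/2) F R ^ (-1/2)` and the
orthogonal projection `P = Hᵀ H`. A unit eigenvector would be an unobservable eigenvector of `F`.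
Outside the critical block the dynamics are those of `G`, which has no unit eigenvalue. -/
theorem norm_lt_one_of_gain {n m : ℕ} {A : Matrix (Fin n) (Fin n) ℝ}
    {C : Matrix (Fin m) (Fin n) ℝ} (hA : NeutrallyStable A) (hC : Detectable C A)
    {L : Matrix (Fin n) (Fin m) ℝ} (hL : IsAlgorithmGain A C L) {l μ : ℂ} (hl : ‖l‖ < 1)
    {y : Fin n → ℂ} (hy : y ≠ 0)
    (h : y ᵥ* cplx A + (l - 1) • (y ᵥ* cplx (L * C)) = μ • y) : ‖μ‖ < 1 := by
  rcases hL with ⟨h0, rfl⟩ | ⟨-, U, W, q, E, L', hrank, hgain, rfl⟩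
  · have hyA : y ᵥ* cplx A = μ • y := by
      simpa [cplx] using h
    have hev := hasEigenvalue_of_vecMul_eq hy hyA
    exact lt_of_le_of_ne (hA.1 μ hev) (unitEigCount_eq_zero_iff.1 h0 μ hev)
  obtain ⟨T, F, G, R, S, H, hTN, hNT, hblock, hF, -, -, hFR, hS, hSS, hrange, hHH, rfl⟩ := hgain
  have hST : Sᵀ = S := by simpa using hS.isHermitian.eq
  have hSdet : IsUnit S.det := isUnit_iff_ne_zero.2 hS.det_pos.ne'
  have hSi : S * S⁻¹ = 1 := Matrix.mul_nonsing_inv S hSdet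
  have hiS : S⁻¹ * S = 1 := Matrix.nonsing_inv_mul S hSdet
  have hSiT : S⁻¹ᵀ = S⁻¹ := by rw [Matrix.transpose_nonsing_inv, hST]
  have hAN : A * Matrix.fromCols U W = Matrix.fromCols (U * F) (W * G) := by
    have : Matrix.fromCols U W * (T * A * Matrix.fromCols U W) = A * Matrix.fromCols U W := by
      rw [← Matrix.mul_assoc, ← Matrix.mul_assoc, hNT, Matrix.one_mul]
    rw [← this, hblock, Matrix.fromCols_mul_fromBlocks]
    simp
  rw [Matrix.mul_fromCols] at hAN
  obtain ⟨hAU, hAW⟩ := Matrix.fromCols_inj.eq_iff.1 hAN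
  -- The output matrix factors through `H`, with an invertible left factor.
  set M := E * C * U * S⁻¹ * Hᵀ with hM
  obtain ⟨X, hX⟩ := exists_eq_mul_of_range_le hrange.ge
  obtain ⟨Y, hY⟩ := exists_eq_mul_of_range_le hrange.le
  have hK : E * C * U * S⁻¹ = M * H := by
    have hKT : E * C * U * S⁻¹ = Xᵀ * H := by
      have := congrArg Matrix.transpose hX
      simpa [Matrix.transpose_mul, hSiT, Matrix.mul_assoc] using this
    rw [hM, hKT, Matrix.mul_assoc Xᵀ H, hHH, Matrix.mul_one]
  have hMdet : IsUnit M.det := by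
    have hYM : Yᵀ * M = 1 := by
      have hH : H = Yᵀ * (E * C * U * S⁻¹) := by
        have := congrArg Matrix.transpose hY
        simpa [Matrix.transpose_mul, hSiT, Matrix.mul_assoc] using this
      rw [hM, ← Matrix.mul_assoc, ← hH, hHH]
    exact Matrix.isUnit_det_of_left_inverse hYM
  have hLCU : U * F * S⁻¹ * Hᵀ * M⁻¹ * E * C * U = U * F * S⁻¹ * (Hᵀ * H) * S := by
    have : E * C * U = M * H * S := by rw [← hK, Matrix.mul_assoc _ S⁻¹ S, hiS, Matrix.mul_one]
    calc _ = U * F * S⁻¹ * Hᵀ * M⁻¹ * (E * C * U) := by simp only [Matrix.mul_assoc]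
      _ = U * F * S⁻¹ * Hᵀ * (M⁻¹ * M) * H * S := by rw [this]; simp only [Matrix.mul_assoc]
      _ = _ := by rw [Matrix.nonsing_inv_mul M hMdet]; simp only [Matrix.mul_assoc, Matrix.mul_one]
  set a := y ᵥ* cplx U with ha
  by_cases ha0 : a = 0
  · -- The critical component vanishes, so the feedback does, and `μ` is an eigenvalue of `G`.
    have hyA : y ᵥ* cplx A = μ • y := by
      rw [← h]
      simp only [Matrix.mul_assoc, cplx_mul U]
      rw [← Matrix.vecMul_vecMul, ← ha, ha0, Matrix.zero_vecMul, smul_zero, add_zero]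
    have hb : y ᵥ* cplx W ≠ 0 := by
      intro hb
      refine hy ?_
      have hN : y ᵥ* cplx (Matrix.fromCols U W) = 0 := by
        ext (i | i)
        · exact congrFun (ha.symm.trans ha0) i
        · exact congrFun hb i
      rw [← Matrix.vecMul_one y, ← cplx_one, ← hNT, cplx_mul, ← Matrix.vecMul_vecMul, hN,
        Matrix.zero_vecMul]
    have hG : (complexEnd G).HasEigenvalue μ := by
      refine hasEigenvalue_of_vecMul_eq hb ?_
      rw [Matrix.vecMul_vecMul, ← cplx_mul, ← hAW, cplx_mul, ← Matrix.vecMul_vecMul, hyA,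
        Matrix.smul_vecMul]
    have hcount := unitEigCount_of_block hTN hNT hblock
    rw [unitEigCount_eq_of_forall hF] at hcount
    exact lt_of_le_of_ne (hA.1 μ (hasEigenvalue_of_vecMul_eq hy hyA))
      (unitEigCount_eq_zero_iff.1 (by omega) μ hG)
  set O := S * F * S⁻¹ with hO
  set P := Hᵀ * H with hP
  set c := a ᵥ* cplx S⁻¹ with hc
  have hac : a = c ᵥ* cplx S := by
    rw [hc, Matrix.vecMul_vecMul, ← cplx_mul, hiS, cplx_one, Matrix.vecMul_one]
  have hc0 : c ≠ 0 := fun h => ha0 (by rw [hac, h, Matrix.zero_vecMul])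
  have hOO : O * Oᵀ = 1 := by
    refine mul_eq_one_comm.1 ?_
    calc Oᵀ * O = S⁻¹ * (Fᵀ * (S * S) * F) * S⁻¹ := by
          simp only [hO, Matrix.transpose_mul, hST, hSiT, Matrix.mul_assoc]
      _ = (S⁻¹ * S) * (S * S⁻¹) := by rw [hSS, hFR, ← hSS]; simp only [Matrix.mul_assoc]
      _ = 1 := by rw [hiS, hSi, Matrix.one_mul]
  have hPT : Pᵀ = P := by rw [hP, Matrix.transpose_mul, Matrix.transpose_transpose]
  have hPP : P * P = P := by
    calc P * P = Hᵀ * (H * Hᵀ) * H := by simp only [hP, Matrix.mul_assoc]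
      _ = P := by rw [hHH, Matrix.mul_one]
  have hmode : c ᵥ* cplx O + (l - 1) • (c ᵥ* cplx O ᵥ* cplx P) = μ • c := by
    have h1 : c ᵥ* cplx O = y ᵥ* cplx A ᵥ* cplx (U * S⁻¹) := by
      have : A * (U * S⁻¹) = U * S⁻¹ * O := by
        calc A * (U * S⁻¹) = U * F * S⁻¹ := by rw [← Matrix.mul_assoc, hAU]
          _ = U * (S⁻¹ * S) * F * S⁻¹ := by rw [hiS, Matrix.mul_one]
          _ = U * S⁻¹ * O := by simp only [hO, Matrix.mul_assoc]
      rw [hc, ha]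
      simp only [Matrix.vecMul_vecMul, ← cplx_mul, this]
    have h2 : c ᵥ* cplx O ᵥ* cplx P =
        y ᵥ* cplx (U * F * S⁻¹ * Hᵀ * M⁻¹ * E * C) ᵥ* cplx (U * S⁻¹) := by
      have : U * F * S⁻¹ * Hᵀ * M⁻¹ * E * C * (U * S⁻¹) = A * (U * S⁻¹) * P := by
        calc _ = U * F * S⁻¹ * Hᵀ * M⁻¹ * E * C * U * S⁻¹ := by simp only [Matrix.mul_assoc]
          _ = U * F * S⁻¹ * P * (S * S⁻¹) := by rw [hLCU]; simp only [Matrix.mul_assoc]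
          _ = A * (U * S⁻¹) * P := by rw [hSi, Matrix.mul_one, ← hAU]; simp only [Matrix.mul_assoc]
      rw [h1, Matrix.vecMul_vecMul y, ← cplx_mul, Matrix.vecMul_vecMul, ← cplx_mul,
        Matrix.vecMul_vecMul, ← cplx_mul, this]
    rw [h1, ← h1, h2, h1, ← Matrix.smul_vecMul, ← Matrix.add_vecMul, h, Matrix.smul_vecMul,
      cplx_mul, ← Matrix.vecMul_vecMul]
  rcases norm_lt_one_or_of_damped (O := cplx Oᵀ) (P := cplx P) (l := l) (μ := μ) (c := c)
      (by rw [cplx_conjTranspose, ← cplx_mul, Matrix.transpose_transpose, hOO, cplx_one])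
      (by rw [cplx_conjTranspose, hPT]) (by rw [← cplx_mul, hPP]) hl hc0
      (by
        rw [← Matrix.vecMul_transpose, ← Matrix.vecMul_transpose]
        simpa only [← Matrix.transpose_map, Matrix.transpose_transpose, hPT] using hmode)
    with hlt | ⟨hμ, hOc, hPc⟩
  · exact hlt
  exfalso
  have hμ0 : μ ≠ 0 := norm_ne_zero_iff.1 (by rw [hμ]; exact one_ne_zero)
  have hOc' : cplx O *ᵥ c = μ⁻¹ • c := by
    have := congrArg (cplx O *ᵥ ·) hOc
    simp only [Matrix.mulVec_mulVec, ← cplx_mul, hOO, cplx_one, Matrix.one_mulVec,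
      Matrix.mulVec_smul] at this
    conv_rhs => rw [this]
    rw [smul_smul, inv_mul_cancel₀ hμ0, one_smul]
  have hHc : cplx H *ᵥ c = 0 := by
    have : H = H * P := by rw [hP, ← Matrix.mul_assoc, hHH, Matrix.one_mul]
    rw [this, cplx_mul, ← Matrix.mulVec_mulVec, hPc, Matrix.mulVec_zero]
  set u := cplx S⁻¹ *ᵥ c with hu
  have hFu : cplx F *ᵥ u = μ⁻¹ • u := by
    have : F * S⁻¹ = S⁻¹ * O := by
      rw [hO, ← Matrix.mul_assoc, ← Matrix.mul_assoc, hiS, Matrix.one_mul]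
    rw [hu, Matrix.mulVec_mulVec, ← cplx_mul, this, cplx_mul, ← Matrix.mulVec_mulVec, hOc',
      Matrix.mulVec_smul]
  have hECu : cplx (E * (C * U)) *ᵥ u = 0 := by
    rw [hu, Matrix.mulVec_mulVec, ← cplx_mul, ← Matrix.mul_assoc, hK, cplx_mul,
      ← Matrix.mulVec_mulVec, hHc, Matrix.mulVec_zero]
  have hCu : cplx (C * U) *ᵥ u = 0 := by
    rw [Matrix.mul_assoc] at hrank
    rw [cplx_mulVec_eq_zero_iff] at hECu ⊢
    exact ⟨mulVec_eq_zero_of_rank_eq hrank hECu.1, mulVec_eq_zero_of_rank_eq hrank hECu.2⟩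
  have hUu := hC.eq_zero_of_unit_mode hAU (by rw [norm_inv, hμ, inv_one]) hFu hCu
  have hu0 : u = 0 := cplx_mulVec_injective (toRows_mul_eq_one hTN).1 hUu
  exact hc0 (cplx_mulVec_injective hSi (hu.symm.trans hu0))

end SyncDual

/-! ### Synchronization -/

namespace SyncDual

/-- The closed loop of `p` coupled systems, whose states are the rows of `X`. -/
noncomputable def loopMap {n p : ℕ} (A B : Matrix (Fin n) (Fin n) ℝ)
    (Λ : Matrix (Fin p) (Fin p) ℝ) : Module.End ℂ (Matrix (Fin p) (Fin n) ℂ) where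
  toFun X := X * cplx A + (cplx Λ - 1) * X * cplx B
  map_add' X Y := by rw [Matrix.add_mul, Matrix.mul_add, Matrix.add_mul]; abel
  map_smul' a X := by simp

/-- States whose weighted average with weights `r` vanishes. -/
def zeroAverage {p : ℕ} (n : ℕ) (r : Fin p → ℝ) : Submodule ℂ (Matrix (Fin p) (Fin n) ℂ) where
  carrier := {X | (fun i => (r i : ℂ)) ᵥ* X = 0}
  add_mem' {X Y} hX hY := by
    change _ ᵥ* _ = 0 at hX hY ⊢
    rw [Matrix.vecMul_add, hX, hY, add_zero]
  zero_mem' := Matrix.vecMul_zero _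
  smul_mem' a X hX := by
    change _ ᵥ* _ = 0 at hX ⊢
    rw [Matrix.vecMul_smul, hX, smul_zero]

lemma mem_zeroAverage {n p : ℕ} {r : Fin p → ℝ} {X : Matrix (Fin p) (Fin n) ℂ} :
    X ∈ zeroAverage n r ↔ (fun i => (r i : ℂ)) ᵥ* X = 0 := Iff.rfl

lemma ofReal_vecMul_cplx {ι κ : Type*} [Fintype ι] (r : ι → ℝ) (M : Matrix ι κ ℝ) :
    (fun i => (r i : ℂ)) ᵥ* cplx M = fun j => (((r ᵥ* M) j : ℝ) : ℂ) := by
  ext j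
  simp [Matrix.vecMul, dotProduct]

section

variable {n m p : ℕ} {A : Matrix (Fin n) (Fin n) ℝ} {C : Matrix (Fin m) (Fin n) ℝ}
  {L : Matrix (Fin n) (Fin m) ℝ} {Λ : Matrix (Fin p) (Fin p) ℝ} {r : Fin p → ℝ}

lemma vecMul_cplx_of_fixed (hr : r ᵥ* Λ = r) :
    (fun i => (r i : ℂ)) ᵥ* cplx Λ = fun i => (r i : ℂ) := by
  rw [ofReal_vecMul_cplx, hr]

lemma loopMap_mem_zeroAverage (B : Matrix (Fin n) (Fin n) ℝ) (hr : r ᵥ* Λ = r) :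
    ∀ X ∈ zeroAverage n r, loopMap A B Λ X ∈ zeroAverage n r := by
  intro X hX
  rw [mem_zeroAverage] at hX ⊢
  change _ ᵥ* (X * cplx A + (cplx Λ - 1) * X * cplx B) = 0
  rw [Matrix.vecMul_add, ← Matrix.vecMul_vecMul, hX, Matrix.zero_vecMul, Matrix.mul_assoc,
    ← Matrix.vecMul_vecMul, Matrix.vecMul_sub, vecMul_cplx_of_fixed hr, Matrix.vecMul_one,
    sub_self, Matrix.zero_vecMul, add_zero]

/-- An eigenvector of the closed loop can be chosen to be an eigenvector of left multiplication by
`Λ` as well, for some eigenvalue `l`. If `l = 1` its rows all coincide, so they vanish since their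
average does; otherwise `|l| < 1`, and a nonzero row is an eigenvector of the coupling mode `l`. -/
lemma norm_lt_one_of_hasEigenvalue_loopMap (hA : NeutrallyStable A) (hC : Detectable C A)
    (hL : IsAlgorithmGain A C L) (hΛ : IsConnected Λ) (hr : r ᵥ* Λ = r) (hr1 : r ⬝ᵥ 1 = 1) {μ : ℂ}
    (hμ : Module.End.HasEigenvalue ((loopMap A (L * C) Λ).restrict
      (loopMap_mem_zeroAverage (L * C) hr)) μ) : ‖μ‖ < 1 := by
  have hmaps : ∀ X ∈ zeroAverage n r, mulLeftLinearMap (Fin n) ℂ (cplx Λ) X ∈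
      zeroAverage n r := by
    intro X hX
    rw [mem_zeroAverage] at hX ⊢
    rw [mulLeftLinearMap_apply, ← Matrix.vecMul_vecMul, vecMul_cplx_of_fixed hr, hX]
  have hcomm : Commute ((loopMap A (L * C) Λ).restrict (loopMap_mem_zeroAverage (L * C) hr))
      (LinearMap.restrict (mulLeftLinearMap (Fin n) ℂ (cplx Λ)) hmaps) := by
    refine LinearMap.ext fun X => Subtype.ext ?_
    change cplx Λ * X.1 * cplx A + (cplx Λ - 1) * (cplx Λ * X.1) * cplx (L * C) =
      cplx Λ * (X.1 * cplx A + (cplx Λ - 1) * X.1 * cplx (L * C))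
    simp only [Matrix.mul_assoc, Matrix.mul_add, Matrix.sub_mul, Matrix.mul_sub, Matrix.one_mul]
  obtain ⟨l, ⟨X, hX⟩, hX0, hN, hl⟩ := exists_common_eigenvector hcomm hμ
  replace hX0 : X ≠ 0 := fun h => hX0 (Subtype.ext h)
  replace hN : X * cplx A + (cplx Λ - 1) * X * cplx (L * C) = μ • X := congrArg Subtype.val hN
  replace hl : cplx Λ * X = l • X := congrArg Subtype.val hl
  have hcol : ∀ j, cplx Λ *ᵥ (fun i => X i j) = l • fun i => X i j := fun j => by
    ext i
    exact congrFun (congrFun hl i) j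
  obtain ⟨i₀, hi₀⟩ := Function.ne_iff.1 hX0
  obtain ⟨j₀, hij₀⟩ := Function.ne_iff.1 hi₀
  have hev : (complexEnd Λ).HasEigenvalue l :=
    Module.End.hasEigenvalue_of_hasEigenvector (x := fun i => X i j₀)
      ⟨Module.End.mem_eigenspace_iff.2 (hcol j₀), fun h => hij₀ (congrFun h i₀)⟩
  rcases hΛ.eigenvalue_eq_one_or_norm_lt_one hev with rfl | hlt
  · exfalso
    obtain ⟨t, ht⟩ := hΛ.exists_forall_eq_of_mulVec_eq
    have hconst : ∀ i, X i j₀ = X t j₀ := by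
      intro i
      have h := hcol j₀
      rw [one_smul] at h
      refine Complex.ext (ht (fun i => (X i j₀).re) ?_ i) (ht (fun i => (X i j₀).im) ?_ i)
      · ext k
        rw [← cplx_mulVec_re, h]
      · ext k
        rw [← cplx_mulVec_im, h]
    have h := congrFun (mem_zeroAverage.1 hX) j₀
    simp only [Matrix.vecMul, dotProduct, hconst, ← Finset.sum_mul, Pi.zero_apply] at h
    rw [dotProduct_one] at hr1
    rw [← Complex.ofReal_sum, hr1, Complex.ofReal_one, one_mul] at h
    exact hij₀ ((hconst i₀).trans h)
  · refine norm_lt_one_of_gain hA hC hL hlt (y := X i₀) hi₀ ?_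
    rw [Matrix.sub_mul, hl, Matrix.one_mul, ← one_smul ℂ X, smul_smul, mul_one, ← sub_smul,
      one_smul, Matrix.smul_mul] at hN
    exact congrFun hN i₀

/-- The disagreement with the weighted average obeys the closed loop on the states of average zero,
where all eigenvalues lie in the open unit disc. -/
theorem tendsto_disagreement (hA : NeutrallyStable A) (hC : Detectable C A)
    (hL : IsAlgorithmGain A C L) (hΛ : IsConnected Λ) (hr : r ᵥ* Λ = r) (hr1 : r ⬝ᵥ 1 = 1)
    {X : ℕ → Matrix (Fin p) (Fin n) ℝ}
    (hX : ∀ k, X (k + 1) = X k * A + (Λ - 1) * X k * (L * C)) (i : Fin p) (j : Fin n) :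
    Tendsto (fun k => X k i j - (r ᵥ* X k) j) atTop (𝓝 0) := by
  set D : ℕ → Matrix (Fin p) (Fin n) ℝ := fun k => X k - Matrix.vecMulVec 1 (r ᵥ* X k) with hD
  have hΛ1 : ∀ v : Fin n → ℝ, (Λ - 1) * Matrix.vecMulVec (1 : Fin p → ℝ) v = 0 := fun v => by
    rw [Matrix.mul_vecMulVec, Matrix.sub_mulVec, hΛ.mulVec_one, Matrix.one_mulVec, sub_self,
      Matrix.zero_vecMulVec]
  have hrX : ∀ k, r ᵥ* X (k + 1) = r ᵥ* X k ᵥ* A := fun k => by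
    rw [hX, Matrix.vecMul_add, Matrix.mul_assoc, ← Matrix.vecMul_vecMul r (Λ - 1),
      Matrix.vecMul_sub, hr, Matrix.vecMul_one, sub_self, Matrix.zero_vecMul, add_zero,
      Matrix.vecMul_vecMul]
  have hstep : ∀ k, D (k + 1) = D k * A + (Λ - 1) * D k * (L * C) := fun k => by
    simp only [hD]
    rw [hrX, hX, Matrix.mul_sub, hΛ1, sub_zero, Matrix.sub_mul (X k), Matrix.vecMulVec_mul]
    abel
  have hD0 : cplx (D 0) ∈ zeroAverage n r := by
    rw [mem_zeroAverage, ofReal_vecMul_cplx]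
    simp only [hD]
    rw [Matrix.vecMul_sub, Matrix.vecMul_vecMulVec, hr1, one_smul, sub_self]
    ext
    simp
  set N := (loopMap A (L * C) Λ).restrict (loopMap_mem_zeroAverage (L * C) hr) with hN
  have hpow : ∀ k : ℕ, ((N ^ k) ⟨cplx (D 0), hD0⟩).1 = cplx (D k) := by
    intro k
    induction k with
    | zero => rfl
    | succ k ih =>
      rw [pow_succ', Module.End.mul_apply, hN, LinearMap.coe_restrict_apply, ← hN, ih, hstep]
      change cplx (D k) * cplx A + (cplx Λ - 1) * cplx (D k) * cplx (L * C) = _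
      rw [cplx_add, cplx_mul (D k) A, cplx_mul _ (L * C), cplx_mul _ (D k), cplx_sub Λ 1, cplx_one]
  have hlim := tendsto_pow_apply_of_eigenvalue_norm_lt_one N
    (fun μ hμ => norm_lt_one_of_hasEigenvalue_loopMap hA hC hL hΛ hr hr1 hμ)
    (Matrix.entryLinearMap ℂ ℂ i j ∘ₗ (zeroAverage n r).subtype) ⟨cplx (D 0), hD0⟩
  have hre := (Complex.continuous_re.tendsto 0).comp hlim
  refine hre.congr fun k => ?_
  simp only [Function.comp_apply, LinearMap.comp_apply, Submodule.subtype_apply, hpow]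
  simp [hD]

/-- The rows of the closed loop are the solutions of the coupled systems, and the weighted average
follows the uncoupled dynamics. -/
theorem synchronizeTo_of_isSolution (hA : NeutrallyStable A) (hC : Detectable C A)
    (hL : IsAlgorithmGain A C L) (hΛ : IsConnected Λ) (hr : r ᵥ* Λ = r) (hr1 : r ⬝ᵥ 1 = 1)
    {x : Fin p → ℕ → Fin n → ℝ} (hx : IsSolution A C Lᵀ Λ x) :
    SynchronizeTo x (fun k => kronApply r (A ^ k)ᵀ (fun i => x i 0)) := by
  set X : ℕ → Matrix (Fin p) (Fin n) ℝ := fun k => Matrix.of fun i => x i k with hXdef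
  have hcoup : ∀ k i, coupling Λ (fun j => x j k) i = ((Λ - 1) * X k : Matrix (Fin p) (Fin n) ℝ) i := by
    intro k i
    ext j
    rw [Matrix.sub_mul, Matrix.one_mul]
    simp [coupling, hXdef, Finset.sum_apply, Matrix.mul_apply, mul_sub, Finset.sum_sub_distrib,
      ← Finset.sum_mul, hΛ.row_sum]
  have hX : ∀ k, X (k + 1) = X k * A + (Λ - 1) * X k * (L * C) := by
    intro k
    ext i j
    have h := congrFun (hx i k) j
    rw [hcoup, Matrix.mulVec_mulVec, ← Matrix.transpose_mul, Matrix.mulVec_transpose,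
      Matrix.mulVec_transpose] at h
    exact h
  have hbar : ∀ k, r ᵥ* X k = kronApply r (A ^ k)ᵀ (fun i => x i 0) := by
    intro k
    have h1 : r ᵥ* X k = r ᵥ* X 0 ᵥ* A ^ k := by
      induction k with
      | zero => simp
      | succ k ih =>
        rw [hX, Matrix.vecMul_add, Matrix.mul_assoc, ← Matrix.vecMul_vecMul r (Λ - 1),
          Matrix.vecMul_sub, hr, Matrix.vecMul_one, sub_self, Matrix.zero_vecMul, add_zero,
          ← Matrix.vecMul_vecMul, ih, Matrix.vecMul_vecMul, pow_succ]
    rw [h1]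
    ext l
    simp only [kronApply, Matrix.mulVec, dotProduct, Fintype.sum_prod_type, Matrix.vecMul,
      Matrix.kroneckerMap_apply, Matrix.replicateRow_apply, Matrix.transpose_apply,
      Finset.sum_mul, hXdef, Matrix.of_apply]
    rw [Finset.sum_comm]
    exact Finset.sum_congr rfl fun i _ => Finset.sum_congr rfl fun j _ => by ring
  intro i
  have h : Tendsto (fun k => x i k - kronApply r (A ^ k)ᵀ (fun i => x i 0)) atTop (𝓝 0) := by
    refine tendsto_pi_nhds.2 fun j => ?_
    refine (tendsto_disagreement hA hC hL hΛ hr hr1 hX i j).congr fun k => ?_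
    rw [hbar]
    rfl
  have h2 := (((PiLp.continuous_toLp 2 (fun _ : Fin n => ℝ)).tendsto 0).comp h).norm
  simpa using h2

end

end SyncDual

/-! ### The construction can be carried out -/

namespace SyncDual

section Spectral

open Polynomial

/-- The complex roots of an irreducible real polynomial are a single number and its conjugate, so
they all have the same norm. -/
lemma norm_eq_one_of_irreducible {f : ℝ[X]} (hf : Irreducible f) {z w : ℂ} (hz : aeval z f = 0)
    (hz1 : ‖z‖ = 1) (hw : aeval w f = 0) : ‖w‖ = 1 := by
  set q : ℝ[X] := X ^ 2 - C (2 * z.re) * X + 1 with hq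
  have hsq : z.re * z.re + z.im * z.im = 1 := by
    rw [← Complex.normSq_apply, Complex.normSq_eq_norm_sq, hz1, one_pow]
  have hqv : ∀ v : ℂ, aeval v q = (v - z) * (v - (starRingEnd ℂ) z) := by
    intro v
    have h1 : z + (starRingEnd ℂ) z = (((2 : ℝ) : ℂ) * (z.re : ℂ)) := by
      rw [Complex.add_conj, Complex.ofReal_mul]
    have h2 : z * (starRingEnd ℂ) z = 1 := by
      rw [Complex.mul_conj, Complex.normSq_apply, hsq, Complex.ofReal_one]
    simp only [hq, map_add, map_sub, map_mul, map_pow, aeval_X, aeval_C, map_one,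
      Complex.coe_algebraMap]
    rw [← h1, ← h2]
    ring
  have hdvd : f ∣ q := by
    by_contra hnd
    obtain ⟨a, b, hab⟩ := (hf.coprime_iff_not_dvd).2 hnd
    have := congrArg (aeval z) hab
    simp [hz, hqv] at this
  obtain ⟨g, hg⟩ := hdvd
  have hqw := hqv w
  rw [hg, map_mul, hw, zero_mul] at hqw
  rcases mul_eq_zero.1 hqw.symm with h | h
  · rw [sub_eq_zero.1 h, hz1]
  · rw [sub_eq_zero.1 h, Complex.norm_conj, hz1]

lemma exists_unit_factorization {f : ℝ[X]} (hf : f ≠ 0) :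
    ∃ g h : ℝ[X], f = g * h ∧ (∀ z : ℂ, aeval z g = 0 → ‖z‖ = 1) ∧
      ∀ z : ℂ, aeval z h = 0 → ‖z‖ ≠ 1 := by
  induction f using WfDvdMonoid.induction_on_irreducible with
  | zero => exact absurd rfl hf
  | unit u hu =>
    refine ⟨1, u, (one_mul u).symm, fun z hz => ?_, fun z hz => ?_⟩
    · simp at hz
    · exact absurd hz (hu.map (aeval z)).ne_zero
  | mul a i ha hi ih =>
    obtain ⟨g, h, rfl, hg, hh⟩ := ih ha
    by_cases hex : ∃ z : ℂ, aeval z i = 0 ∧ ‖z‖ = 1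
    · obtain ⟨z, hz, hz1⟩ := hex
      refine ⟨i * g, h, (mul_assoc i g h).symm, fun w hw => ?_, hh⟩
      rw [map_mul] at hw
      rcases mul_eq_zero.1 hw with hw | hw
      · exact norm_eq_one_of_irreducible hi hz hz1 hw
      · exact hg w hw
    · refine ⟨g, i * h, mul_left_comm i g h, hg, fun w hw hw1 => ?_⟩
      rw [map_mul] at hw
      rcases mul_eq_zero.1 hw with hw | hw
      · exact hex ⟨w, hw, hw1⟩
      · exact hh w hw hw1

lemma cplx_aeval_mulVec {n : ℕ} {A : Matrix (Fin n) (Fin n) ℝ} {μ : ℂ} {w : Fin n → ℂ}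
    (h : cplx A *ᵥ w = μ • w) (f : ℝ[X]) : cplx (aeval A f) *ᵥ w = aeval μ f • w := by
  induction f using Polynomial.induction_on' with
  | add f g hf hg => rw [map_add, cplx_add, Matrix.add_mulVec, hf, hg, map_add, add_smul]
  | monomial k a =>
    rw [aeval_monomial, aeval_monomial, ← Algebra.smul_def, Complex.coe_algebraMap]
    have : cplx (a • A ^ k) = (a : ℂ) • cplx (A ^ k) := by
      ext i j
      simp
    rw [this, Matrix.smul_mulVec, cplx_pow_mulVec h, smul_smul]

/-- Every eigenvalue of the restriction `F` of `A` to a subspace annihilated by `f(A)` is a root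
of `f`. -/
lemma aeval_eq_zero_of_restriction {n n₁ : ℕ} {A : Matrix (Fin n) (Fin n) ℝ}
    {U : Matrix (Fin n) (Fin n₁) ℝ} {V : Matrix (Fin n₁) (Fin n) ℝ}
    {F : Matrix (Fin n₁) (Fin n₁) ℝ} (hVU : V * U = 1) (hAU : A * U = U * F) {f : ℝ[X]}
    (hf : aeval A f * U = 0) {μ : ℂ} (hμ : (complexEnd F).HasEigenvalue μ) : aeval μ f = 0 := by
  obtain ⟨u, hu⟩ := hμ.exists_hasEigenvector
  have hFu : cplx F *ᵥ u = μ • u := hu.apply_eq_smul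
  have hAw : cplx A *ᵥ (cplx U *ᵥ u) = μ • (cplx U *ᵥ u) := by
    rw [Matrix.mulVec_mulVec, ← cplx_mul, hAU, cplx_mul, ← Matrix.mulVec_mulVec, hFu,
      Matrix.mulVec_smul]
  have h := cplx_aeval_mulVec hAw f
  rw [Matrix.mulVec_mulVec, ← cplx_mul, hf] at h
  have h0 : cplx (0 : Matrix (Fin n) (Fin n₁) ℝ) *ᵥ u = 0 := by simp [cplx]
  rw [h0] at h
  exact (smul_eq_zero.1 h.symm).resolve_right fun hw => hu.2 (cplx_mulVec_injective hVU hw)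

/-- The characteristic polynomial splits into a factor `f` with its unit roots and a factor `g`
with the others; the two invariant subspaces are the kernels of `f(A)` and `g(A)`. -/
lemma exists_unit_splitting {n : ℕ} (A : Matrix (Fin n) (Fin n) ℝ) :
    ∃ (U : Matrix (Fin n) (Fin (unitEigCount A)) ℝ)
      (W : Matrix (Fin n) (Fin (n - unitEigCount A)) ℝ)
      (T : Matrix (Fin (unitEigCount A) ⊕ Fin (n - unitEigCount A)) (Fin n) ℝ)
      (F : Matrix (Fin (unitEigCount A)) (Fin (unitEigCount A)) ℝ)
      (G : Matrix (Fin (n - unitEigCount A)) (Fin (n - unitEigCount A)) ℝ),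
      T * Matrix.fromCols U W = 1 ∧ Matrix.fromCols U W * T = 1 ∧
      T * A * Matrix.fromCols U W = Matrix.fromBlocks F 0 0 G ∧ A * U = U * F ∧
      (∀ μ : ℂ, (complexEnd F).HasEigenvalue μ → ‖μ‖ = 1) := by
  obtain ⟨f, g, hfg, hf, hg⟩ := exists_unit_factorization (Matrix.charpoly_monic A).ne_zero
  have hcop : IsCoprime f g := by
    refine (isCoprime_iff_aeval_ne_zero_of_isAlgClosed ℝ ℂ f g).2 fun z => ?_
    by_cases hz : aeval z f = 0
    · exact Or.inr fun h => hg z h (hf z hz)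
    · exact Or.inl hz
  set a := Matrix.toLinAlgEquiv' A with ha
  have haev : ∀ (h : ℝ[X]) v, aeval a h v = aeval A h *ᵥ v := fun h v => by
    rw [ha, aeval_algHom_apply (Matrix.toLinAlgEquiv' : Matrix (Fin n) (Fin n) ℝ ≃ₐ[ℝ] _) A h,
      Matrix.toLinAlgEquiv'_apply]
  have hcompl : IsCompl (LinearMap.ker (aeval a f)) (LinearMap.ker (aeval a g)) := by
    refine ⟨disjoint_ker_aeval_of_isCoprime a hcop, codisjoint_iff.2 ?_⟩
    rw [sup_ker_aeval_eq_ker_aeval_mul_of_coprime a hcop, ← hfg, LinearMap.ker_eq_top]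
    refine LinearMap.ext fun v => ?_
    rw [haev, Matrix.aeval_self_charpoly, Matrix.zero_mulVec, LinearMap.zero_apply]
  let bf := Module.finBasis ℝ (LinearMap.ker (aeval a f))
  let bg := Module.finBasis ℝ (LinearMap.ker (aeval a g))
  let b := (bf.prod bg).map (Submodule.prodEquivOfIsCompl _ _ hcompl)
  let U := Matrix.of fun i j => (bf j : Fin n → ℝ) i
  let W := Matrix.of fun i j => (bg j : Fin n → ℝ) i
  have hN : Matrix.fromCols U W = (Pi.basisFun ℝ (Fin n)).toMatrix b := by
    ext i (j | j) <;> simp [U, W, b, Module.Basis.toMatrix_apply]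
  have hTN : b.toMatrix (Pi.basisFun ℝ (Fin n)) * Matrix.fromCols U W = 1 := by
    rw [hN, Module.Basis.toMatrix_mul_toMatrix_flip]
  have hNT : Matrix.fromCols U W * b.toMatrix (Pi.basisFun ℝ (Fin n)) = 1 := by
    rw [hN, Module.Basis.toMatrix_mul_toMatrix_flip]
  -- Any invariant subspace `ker h(A)` is closed under `A`, because `h(A)` commutes with `A`.
  have hinv : ∀ (h : ℝ[X]) {d : ℕ} (β : Module.Basis (Fin d) ℝ (LinearMap.ker (aeval a h))),
      (∃ F : Matrix (Fin d) (Fin d) ℝ, A * Matrix.of (fun i j => (β j : Fin n → ℝ) i) =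
        Matrix.of (fun i j => (β j : Fin n → ℝ) i) * F) ∧
      aeval A h * Matrix.of (fun i j => (β j : Fin n → ℝ) i) = 0 := by
    intro h d β
    have hz : aeval A h * Matrix.of (fun i j => (β j : Fin n → ℝ) i) = 0 := by
      ext i j
      have := congrFun (LinearMap.mem_ker.1 (β j).2) i
      rw [haev] at this
      exact this
    refine ⟨exists_eq_mul_of_range_le ?_, hz⟩
    have hcomm : aeval A h * A = A * aeval A h := by
      simpa using congrArg (aeval A) (mul_comm h X)
    rintro _ ⟨v, rfl⟩
    have hmem : (A * Matrix.of (fun i j => (β j : Fin n → ℝ) i)) *ᵥ v ∈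
        LinearMap.ker (aeval a h) := by
      rw [LinearMap.mem_ker, haev, Matrix.mulVec_mulVec, ← Matrix.mul_assoc,
        hcomm, Matrix.mul_assoc, hz, Matrix.mul_zero,
        Matrix.zero_mulVec]
    refine ⟨β.equivFun ⟨_, hmem⟩, ?_⟩
    have hs := congrArg Subtype.val (β.sum_equivFun ⟨_, hmem⟩)
    rw [Submodule.coe_sum] at hs
    refine Eq.trans ?_ hs
    ext i
    simp [Matrix.mulVec, dotProduct, Finset.sum_apply, mul_comm]
  obtain ⟨⟨F, hAU⟩, hfU⟩ := hinv f bf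
  obtain ⟨⟨G, hAW⟩, hgW⟩ := hinv g bg
  have hblock : b.toMatrix (Pi.basisFun ℝ (Fin n)) * A * Matrix.fromCols U W =
      Matrix.fromBlocks F 0 0 G := by
    have : A * Matrix.fromCols U W = Matrix.fromCols U W * Matrix.fromBlocks F 0 0 G := by
      rw [Matrix.mul_fromCols, Matrix.fromCols_mul_fromBlocks, hAU, hAW]
      simp [U, W]
    rw [Matrix.mul_assoc, this, ← Matrix.mul_assoc, hTN, Matrix.one_mul]
  obtain ⟨hVU, hVW⟩ := toRows_mul_eq_one hTN
  have hF : ∀ μ : ℂ, (complexEnd F).HasEigenvalue μ → ‖μ‖ = 1 := fun μ hμ =>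
    hf μ (aeval_eq_zero_of_restriction hVU hAU hfU hμ)
  have hG : ∀ μ : ℂ, (complexEnd G).HasEigenvalue μ → ‖μ‖ ≠ 1 := fun μ hμ =>
    hg μ (aeval_eq_zero_of_restriction hVW hAW hgW hμ)
  have hcount := unitEigCount_of_block hTN hNT hblock
  rw [unitEigCount_eq_of_forall hF, unitEigCount_eq_zero_iff.2 hG, add_zero] at hcount
  have hdim := Matrix.square_of_invertible _ _ hTN hNT
  rw [Fintype.card_sum, Fintype.card_fin, Fintype.card_fin, Fintype.card_fin] at hdim
  have hdim' : n - unitEigCount A = Module.finrank ℝ (LinearMap.ker (aeval a g)) := by omega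
  rw [hdim', hcount]
  exact ⟨U, W, _, F, G, hTN, hNT, hblock, hAU, hF⟩

end Spectral

/-- A restriction of a neutrally stable matrix to critical modes is diagonalizable over `ℂ`. -/
lemma iSup_eigenspace_eq_top {n n₁ : ℕ} {A : Matrix (Fin n) (Fin n) ℝ} (hA : NeutrallyStable A)
    {U : Matrix (Fin n) (Fin n₁) ℝ} {V : Matrix (Fin n₁) (Fin n) ℝ}
    {F : Matrix (Fin n₁) (Fin n₁) ℝ} (hVU : V * U = 1) (hAU : A * U = U * F)
    (hF : ∀ μ : ℂ, (complexEnd F).HasEigenvalue μ → ‖μ‖ = 1) :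
    ⨆ μ, (complexEnd F).eigenspace μ = ⊤ := by
  rw [eq_top_iff, ← Module.End.iSup_maxGenEigenspace_eq_top (complexEnd F)]
  refine iSup_mono fun μ u hu => ?_
  have hinter : ∀ v, (complexEnd A - algebraMap ℂ _ μ) (cplx U *ᵥ v) =
      cplx U *ᵥ ((complexEnd F - algebraMap ℂ _ μ) v) := by
    intro v
    change cplx A *ᵥ (cplx U *ᵥ v) - μ • (cplx U *ᵥ v) = cplx U *ᵥ (cplx F *ᵥ v - μ • v)
    rw [Matrix.mulVec_sub, Matrix.mulVec_mulVec, Matrix.mulVec_mulVec, ← cplx_mul, ← cplx_mul, hAU,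
      Matrix.mulVec_smul]
  have hpow : ∀ (k : ℕ) v, ((complexEnd A - algebraMap ℂ _ μ) ^ k) (cplx U *ᵥ v) =
      cplx U *ᵥ (((complexEnd F - algebraMap ℂ _ μ) ^ k) v) := by
    intro k
    induction k with
    | zero => exact fun v => rfl
    | succ k ih =>
      intro v
      rw [pow_succ, pow_succ, Module.End.mul_apply, Module.End.mul_apply, hinter, ih]
  by_cases hev : (complexEnd F).HasEigenvalue μ
  · have hevA : (complexEnd A).HasEigenvalue μ := by
      obtain ⟨v, hv⟩ := hev.exists_hasEigenvector
      refine Module.End.hasEigenvalue_of_hasEigenvector (x := cplx U *ᵥ v)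
        ⟨Module.End.mem_eigenspace_iff.2 ?_, fun h => hv.2 (cplx_mulVec_injective hVU h)⟩
      have h := hinter v
      rw [LinearMap.sub_apply, LinearMap.sub_apply, hv.apply_eq_smul,
        Module.algebraMap_end_apply, Module.algebraMap_end_apply, sub_self, Matrix.mulVec_zero] at h
      exact sub_eq_zero.1 h
    obtain ⟨k, hk⟩ := Module.End.mem_maxGenEigenspace _ _ _ |>.1 hu
    have hUu : cplx U *ᵥ u ∈ (complexEnd A).maxGenEigenspace μ := by
      refine (Module.End.mem_maxGenEigenspace _ _ _).2 ⟨k, ?_⟩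
      have := hpow k u
      rw [Algebra.algebraMap_eq_smul_one, Algebra.algebraMap_eq_smul_one, hk,
        Matrix.mulVec_zero] at this
      exact this
    rw [hA.2 μ hevA (hF μ hev), Module.End.mem_eigenspace_iff] at hUu
    refine Module.End.mem_eigenspace_iff.2 (sub_eq_zero.1 (cplx_mulVec_injective hVU ?_))
    exact (hinter u).symm.trans (sub_eq_zero.2 hUu)
  · have hbot : (complexEnd F).maxGenEigenspace μ = ⊥ := by
      by_contra hne
      exact hev (Module.End.HasUnifEigenvalue.lt zero_lt_one hne)
    rw [hbot, Submodule.mem_bot] at hu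
    rw [hu]
    exact zero_mem _

/-- The coordinates of vectors in an eigenbasis of `F` are the entries of `K v`, where the rows of
`K` are left eigenvectors of `F`. The invariant form is `Re (Kᴴ K)`. -/
lemma exists_invariant_posDef_of_basis {n₁ : ℕ} {F : Matrix (Fin n₁) (Fin n₁) ℝ} {ι : Type*}
    [Fintype ι] [DecidableEq ι] (b : Module.Basis ι ℂ (Fin n₁ → ℂ)) {ν : ι → ℂ}
    (hν : ∀ s, ‖ν s‖ = 1) (hb : ∀ s, cplx F *ᵥ b s = ν s • b s) :
    ∃ R : Matrix (Fin n₁) (Fin n₁) ℝ, R.PosDef ∧ Fᵀ * R * F = R := by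
  set K : Matrix ι (Fin n₁) ℂ := LinearMap.toMatrix' b.equivFun.toLinearMap with hK
  set D : Matrix ι ι ℂ := Matrix.diagonal ν with hD
  have hKv : ∀ v : Fin n₁ → ℂ, K *ᵥ v = b.equivFun v := fun v => LinearMap.toMatrix'_mulVec _ v
  have hKF : K * cplx F = D * K := by
    refine Matrix.toLin'.injective (b.ext fun s => ?_)
    rw [Matrix.toLin'_apply, Matrix.toLin'_apply, ← Matrix.mulVec_mulVec, ← Matrix.mulVec_mulVec,
      hb, Matrix.mulVec_smul, hKv]
    ext t
    rw [Matrix.mulVec_diagonal, Pi.smul_apply, smul_eq_mul, b.equivFun_self]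
    rcases eq_or_ne t s with rfl | hts
    · rfl
    · simp [hts.symm]
  have hDD : Dᴴ * D = 1 := by
    rw [hD, Matrix.diagonal_conjTranspose, Matrix.diagonal_mul_diagonal, ← Matrix.diagonal_one]
    congr 1
    ext s
    rw [Pi.star_apply, Complex.star_def, Complex.conj_mul', hν, Complex.ofReal_one, one_pow]
  have hinv : cplx Fᵀ * (Kᴴ * K) * cplx F = Kᴴ * K := by
    calc cplx Fᵀ * (Kᴴ * K) * cplx F = (K * cplx F)ᴴ * (K * cplx F) := by
          rw [Matrix.conjTranspose_mul, cplx_conjTranspose]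
          simp only [Matrix.mul_assoc]
      _ = Kᴴ * (Dᴴ * D) * K := by
          rw [hKF, Matrix.conjTranspose_mul]
          simp only [Matrix.mul_assoc]
      _ = Kᴴ * K := by rw [hDD, Matrix.mul_one]
  refine ⟨(Kᴴ * K).map Complex.re, Matrix.PosDef.of_dotProduct_mulVec_pos ?_ ?_, ?_⟩
  · ext i j
    have h := congrFun (congrFun (Matrix.isHermitian_conjTranspose_mul_self K).eq i) j
    simpa using congrArg Complex.re h
  · intro x hx
    have hsum : star x ⬝ᵥ (Kᴴ * K).map Complex.re *ᵥ x =
        ∑ s, ‖(K *ᵥ fun j => (x j : ℂ)) s‖ ^ 2 := by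
      have hre : ∀ M : Matrix (Fin n₁) (Fin n₁) ℂ, star x ⬝ᵥ M.map Complex.re *ᵥ x =
          (star (fun j => (x j : ℂ)) ⬝ᵥ M *ᵥ fun j => (x j : ℂ)).re := fun M => by
        simp [dotProduct, Matrix.mulVec]
      rw [hre, ← Matrix.mulVec_mulVec, Matrix.dotProduct_mulVec, ← Matrix.star_mulVec,
        star_dotProduct_self_eq, Complex.ofReal_re]
    rw [hsum]
    refine lt_of_le_of_ne (Finset.sum_nonneg fun _ _ => by positivity) fun h0 => hx ?_
    have hz : K *ᵥ (fun j => (x j : ℂ)) = 0 := by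
      ext s
      have := (Finset.sum_eq_zero_iff_of_nonneg fun _ _ => by positivity).1 h0.symm s
        (Finset.mem_univ s)
      simpa using this
    rw [hKv, LinearEquiv.map_eq_zero_iff] at hz
    ext j
    exact Complex.ofReal_eq_zero.1 (congrFun hz j)
  · have hre : ∀ M : Matrix (Fin n₁) (Fin n₁) ℂ,
        (cplx Fᵀ * M * cplx F).map Complex.re = Fᵀ * M.map Complex.re * F := fun M => by
      ext i j
      simp [Matrix.mul_apply]
    rw [← hre, hinv]

lemma exists_invariant_posDef {n₁ : ℕ} {F : Matrix (Fin n₁) (Fin n₁) ℝ}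
    (hF : ∀ μ : ℂ, (complexEnd F).HasEigenvalue μ → ‖μ‖ = 1)
    (htop : ⨆ μ, (complexEnd F).eigenspace μ = ⊤) :
    ∃ R : Matrix (Fin n₁) (Fin n₁) ℝ, R.PosDef ∧ Fᵀ * R * F = R := by
  classical
  have hint : DirectSum.IsInternal fun μ => (complexEnd F).eigenspace μ :=
    DirectSum.isInternal_submodule_of_iSupIndep_of_iSup_eq_top
      (Module.End.eigenspaces_iSupIndep _) htop
  let b := hint.collectedBasis fun μ => Module.finBasis ℂ ((complexEnd F).eigenspace μ)
  have : Fintype (Σ μ : ℂ, Fin (Module.finrank ℂ ((complexEnd F).eigenspace μ))) :=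
    FiniteDimensional.fintypeBasisIndex b
  have hb : ∀ s, complexEnd F (b s) = s.1 • b s := fun s =>
    Module.End.mem_eigenspace_iff.1 (hint.collectedBasis_mem _ s)
  exact exists_invariant_posDef_of_basis b (ν := fun s => s.1)
    (fun s => hF s.1 (Module.End.hasEigenvalue_of_hasEigenvector
      ⟨Module.End.mem_eigenspace_iff.2 (hb s), b.ne_zero s⟩)) hb

/-- A compression `E` of the output that keeps the rank of `M` and makes it the number of rows. -/
lemma exists_rank_compression {n m : ℕ} (M : Matrix (Fin m) (Fin n) ℝ) :
    ∃ (q : ℕ) (E : Matrix (Fin q) (Fin m) ℝ), (E * M).rank = M.rank ∧ (E * M).rank = q := by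
  let e := (Module.finBasis ℝ (LinearMap.range M.mulVecLin)).equivFun
  obtain ⟨g, hg⟩ := LinearMap.exists_extend e.toLinearMap
  have hrank : (LinearMap.toMatrix' g * M).rank = M.rank := by
    have hrange : LinearMap.range (LinearMap.toMatrix' g * M).mulVecLin = ⊤ := by
      refine LinearMap.range_eq_top.2 fun y => ?_
      obtain ⟨x, hx⟩ := (e.symm y).2
      refine ⟨x, ?_⟩
      have h := LinearMap.congr_fun hg (e.symm y)
      rw [LinearMap.comp_apply, Submodule.subtype_apply, ← hx] at h
      rw [Matrix.mulVecLin_apply, ← Matrix.mulVec_mulVec, LinearMap.toMatrix'_mulVec]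
      refine h.trans ?_
      simp
    rw [Matrix.rank, hrange, finrank_top, Module.finrank_fin_fun]
    rfl
  exact ⟨M.rank, LinearMap.toMatrix' g, hrank, hrank⟩

open scoped MatrixOrder in
lemma exists_posDef_sqrt {n : ℕ} {R : Matrix (Fin n) (Fin n) ℝ} (hR : R.PosDef) :
    ∃ S : Matrix (Fin n) (Fin n) ℝ, S.PosDef ∧ S * S = R := by
  have h := Matrix.isStrictlyPositive_iff_posDef.2 hR
  exact ⟨CFC.sqrt R, Matrix.isStrictlyPositive_iff_posDef.1 (IsStrictlyPositive.sqrt R h),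
    CFC.sqrt_mul_sqrt_self R h.nonneg⟩

/-- Orthonormalization of the columns of `K`, by `Hᵀ = K (Kᵀ K) ^ (-1/2)`. -/
lemma exists_orthonormal_rows {a b : ℕ} {K : Matrix (Fin a) (Fin b) ℝ}
    (hK : Function.Injective K.mulVec) :
    ∃ H : Matrix (Fin b) (Fin a) ℝ,
      LinearMap.range (Hᵀ).mulVecLin = LinearMap.range K.mulVecLin ∧ H * Hᵀ = 1 := by
  have hpos := Matrix.PosDef.conjTranspose_mul_self K hK
  rw [Matrix.conjTranspose_eq_transpose_of_trivial] at hpos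
  obtain ⟨Z, hZ, hZZ⟩ := exists_posDef_sqrt hpos
  have hZT : Zᵀ = Z := by simpa using hZ.isHermitian.eq
  have hdet : IsUnit Z.det := isUnit_iff_ne_zero.2 hZ.det_pos.ne'
  have hHT : (Z⁻¹ * Kᵀ)ᵀ = K * Z⁻¹ := by
    rw [Matrix.transpose_mul, Matrix.transpose_transpose, Matrix.transpose_nonsing_inv, hZT]
  refine ⟨Z⁻¹ * Kᵀ, ?_, ?_⟩
  · rw [hHT, Matrix.mulVecLin_mul]
    refine le_antisymm (LinearMap.range_comp_le_range _ _) ?_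
    rintro _ ⟨x, rfl⟩
    refine ⟨Z *ᵥ x, ?_⟩
    rw [← Matrix.mulVecLin_mul, Matrix.mulVecLin_apply, Matrix.mulVecLin_apply,
      Matrix.mulVec_mulVec, Matrix.mul_assoc, Matrix.nonsing_inv_mul Z hdet, Matrix.mul_one]
  · calc Z⁻¹ * Kᵀ * (Z⁻¹ * Kᵀ)ᵀ = Z⁻¹ * (Kᵀ * K) * Z⁻¹ := by
          rw [hHT]; simp only [Matrix.mul_assoc]
      _ = (Z⁻¹ * Z) * (Z * Z⁻¹) := by rw [← hZZ]; simp only [Matrix.mul_assoc]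
      _ = 1 := by
          rw [Matrix.nonsing_inv_mul Z hdet, Matrix.mul_nonsing_inv Z hdet, Matrix.one_mul]

lemma mulVec_injective_of_rank_eq {a b : ℕ} {K : Matrix (Fin a) (Fin b) ℝ} (h : K.rank = b) :
    Function.Injective K.mulVec := by
  have h1 := LinearMap.finrank_range_add_finrank_ker K.mulVecLin
  rw [Matrix.rank] at h
  rw [h, Module.finrank_fin_fun] at h1
  have h2 : LinearMap.ker K.mulVecLin = ⊥ := Submodule.finrank_eq_zero.1 (by omega)
  exact LinearMap.ker_eq_bot.1 h2

theorem exists_isAlgorithmGain {n m : ℕ} {A : Matrix (Fin n) (Fin n) ℝ} (hA : NeutrallyStable A)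
    (C : Matrix (Fin m) (Fin n) ℝ) : ∃ L, IsAlgorithmGain A C L := by
  by_cases h0 : unitEigCount A = 0
  · exact ⟨0, Or.inl ⟨h0, rfl⟩⟩
  obtain ⟨U, W, T, F, G, hTN, hNT, hblock, hAU, hF⟩ := exists_unit_splitting A
  obtain ⟨R, hR, hFR⟩ := exists_invariant_posDef hF
    (iSup_eigenspace_eq_top hA (toRows_mul_eq_one hTN).1 hAU hF)
  obtain ⟨S, hS, hSS⟩ := exists_posDef_sqrt hR
  obtain ⟨q, E, hrank, hq⟩ := exists_rank_compression (C * U)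
  rw [← Matrix.mul_assoc] at hrank hq
  have hSdet : IsUnit S.det := isUnit_iff_ne_zero.2 hS.det_pos.ne'
  have hinj : Function.Injective (S⁻¹ * Uᵀ * (E * C)ᵀ).mulVec := by
    apply mulVec_injective_of_rank_eq
    rw [Matrix.mul_assoc, ← Matrix.transpose_mul, Matrix.rank_mul_eq_right_of_isUnit_det,
      Matrix.rank_transpose, hq]
    exact Matrix.isUnit_nonsing_inv_det S hSdet
  obtain ⟨H, hrange, hHH⟩ := exists_orthonormal_rows hinj
  exact ⟨_, Or.inr ⟨h0, U, W, q, E, _, hrank,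
    ⟨T, F, G, R, S, H, hTN, hNT, hblock, hF, hq, hR, hFR, hS, hSS, hrange, hHH, rfl⟩, rfl⟩⟩

end SyncDual

theorem theorem3 {n m : ℕ} (A : Matrix (Fin n) (Fin n) ℝ) (C : Matrix (Fin m) (Fin n) ℝ)
    (hA : SyncDual.NeutrallyStable A) (hC : SyncDual.Stabilizable Aᵀ Cᵀ) :
    (∃ L : Matrix (Fin n) (Fin m) ℝ, SyncDual.IsAlgorithmGain A C L) ∧
    ∀ L : Matrix (Fin n) (Fin m) ℝ, SyncDual.IsAlgorithmGain A C L →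
      ∀ (p : ℕ) (Λ : Matrix (Fin p) (Fin p) ℝ), SyncDual.IsConnected Λ →
        (∃! r : Fin p → ℝ, r ᵥ* Λ = r ∧ r ⬝ᵥ 1 = 1) ∧
        ∀ r : Fin p → ℝ, r ᵥ* Λ = r → r ⬝ᵥ 1 = 1 →
          ∀ x : Fin p → ℕ → Fin n → ℝ, SyncDual.IsSolution A C Lᵀ Λ x →
            SyncDual.SynchronizeTo x
              (fun k => SyncDual.kronApply r (A ^ k)ᵀ (fun i => x i 0)) := by
  have hdet : SyncDual.Detectable C A := by
    simpa only [SyncDual.Stabilizable, Matrix.transpose_transpose] using hC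
  exact ⟨SyncDual.exists_isAlgorithmGain hA C, fun L hL p Λ hΛ =>
    ⟨hΛ.existsUnique_left_fixed, fun r hr hr1 x hx =>
      SyncDual.synchronizeTo_of_isSolution hA hdet hL hΛ hr hr1 hx⟩⟩
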